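/- Let $\mathbb{H}$ be the real quaternion algebra. For a quaternion matrix $A$, let $A^{*}$ be its conjugate transpose, $r(A)$ its rank (the maximal number of right linearly independent columns), $A^{\dagger}$ its Moore–Penrose inverse (the unique $X$ with $AXA=A$, $XAX=X$, $(AX)^{*}=AX$, $(XA)^{*}=XA$), $L_A=I-A^{\dagger}A$ and $R_A=I-AA^{\dagger}$. Let $A_i,B_i,C_i$ $(i=1,2,3,4)$ be given matrices over $\mathbb{H}$, of sizes for which the following system in the unknown matrices $X_1,\dots,X_5$ over $\mathbb{H}$ makes sense: $$A_1X_1-X_2B_1=C_1,\quad A_2X_2-X_3B_2=C_2,\quad A_3X_3-X_4B_3=C_3,\quad A_4X_5-X_4B_4=C_4.\tag{$*$}$$ Put $$A_{11}=R_{(A_2A_1)}A_2,\quad B_{11}=R_{B_1}L_{B_2},\quad C_{11}=R_{(A_2A_1)}(A_2R_{A_1}C_1B_1^{\dagger}+C_2)L_{B_2},$$ $$A_{22}=R_{B_3}B_4,\quad B_{22}=R_{A_4}A_3,\quad C_{22}=B_4L_{A_{22}},\quad D_{22}=R_{A_4}(R_{A_3}C_3B_3^{\dagger}B_4-C_4)L_{A_{22}},$$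 $$A_{33}=(A_2A_1,\ -L_{A_3}),\quad B_{33}=\begin{pmatrix}R_{B_2}\\-R_{C_{22}}B_3\end{pmatrix},\quad A_{44}=R_{B_{11}}R_{B_1}B_2^{\dagger},\quad B_{44}=-L_{B_{22}},$$ $$E_1=A_3^{\dagger}C_3+B_{22}^{\dagger}D_{22}C_{22}^{\dagger}B_3+R_{(A_2A_1)}C_2B_2^{\dagger}+A_{11}R_{A_1}C_1B_1^{\dagger}B_2^{\dagger}-C_{11}B_{11}^{\dagger}R_{B_1}B_2^{\dagger},$$ $$A=R_{A_{33}}A_{11},\quad B=A_{44}L_{B_{33}},\quad C=R_{A_{33}}B_{44},\quad D=B_3L_{B_{33}},$$ $$E=R_{A_{33}}E_1L_{B_{33}},\quad M=R_AC,\quad N=DL_B,\quad S=CL_M.$$ Then the following statements are equivalent. (1) The system $(*)$ has a solution. (2) All of the following rank equalities hold: $$r\begin{pmatrix}C_i&A_i\\B_i&0\end{pmatrix}=r(A_i)+r(B_i)\quad(i=1,2,3,4),$$ $$r\begin{pmatrix}A_2C_1+C_2B_1&A_2A_1\\B_2B_1&0\end{pmatrix}=r(A_2A_1)+r(B_2B_1),$$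 $$r\begin{pmatrix}C_3&C_4&A_3&A_4\\B_3&B_4&0&0\end{pmatrix}=r(A_3,\ A_4)+r(B_3,\ B_4),$$ $$r\begin{pmatrix}A_3C_2+C_3B_2&C_4&A_3A_2&A_4\\B_3B_2&B_4&0&0\end{pmatrix}=r(A_3A_2,\ A_4)+r(B_3B_2,\ B_4),$$ $$r\begin{pmatrix}A_3A_2C_1+A_3C_2B_1+C_3B_2B_1&A_3A_2A_1\\B_3B_2B_1&0\end{pmatrix}=r(A_3A_2A_1)+r(B_3B_2B_1),$$ $$r\begin{pmatrix}A_3C_2+C_3B_2&A_3A_2\\B_3B_2&0\end{pmatrix}=r(A_3A_2)+r(B_3B_2),$$ $$r\begin{pmatrix}A_3A_2C_1+A_3C_2B_1+C_3B_2B_1&C_4&A_4&A_3A_2A_1\\B_3B_2B_1&B_4&0&0\end{pmatrix}=r(A_3A_2A_1,\ A_4)+r(B_3B_2B_1,\ B_4).$$ (3) All of the following equalities hold: $$R_{A_1}C_1L_{B_1}=0,\quad R_{A_{11}}C_{11}=0,\quad C_{11}L_{B_{11}}=0,$$ $$R_{A_3}C_3L_{B_3}=0,\quad R_{B_{22}}D_{22}=0,\quad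 D_{22}L_{C_{22}}=0,$$ $$R_MR_AE=0,\quad EL_BL_N=0,\quad R_AEL_D=0,\quad R_CEL_B=0.$$ Moreover, if $(*)$ has a solution, then its general solution is $$X_1=A_1^{\dagger}C_1+U_1B_1+L_{A_1}W_1,\qquad X_2=-R_{A_1}C_1B_1^{\dagger}+A_1U_1+V_1R_{B_1},$$ $$X_3=-R_{(A_2A_1)}(C_2+A_2R_{A_1}C_1B_1^{\dagger}-A_2V_1R_{B_1})B_2^{\dagger}+A_2A_1W_4+W_5R_{B_2},$$ or, equivalently, $X_3=A_3^{\dagger}C_3+U_2B_3+L_{A_3}T_1$, $$X_4=-R_{A_3}C_3B_3^{\dagger}+A_3U_2+V_2R_{B_3},$$ $$X_5=A_4^{\dagger}(C_4-R_{A_3}C_3B_3^{\dagger}B_4+A_3U_2B_4)+T_4A_{22}+L_{A_4}T_6,$$ where $$V_1=A_{11}^{\dagger}C_{11}B_{11}^{\dagger}+L_{A_{11}}W_2+W_3R_{B_{11}},$$ $$U_1=(A_2A_1)^{\dagger}(C_2+A_2R_{A_1}C_1B_1^{\dagger}-A_2V_1R_{B_1})+W_4B_2+L_{(A_2A_1)}W_6,$$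 $$U_2=B_{22}^{\dagger}D_{22}C_{22}^{\dagger}+L_{B_{22}}T_2+T_3R_{C_{22}},$$ $$V_2=-R_{A_4}(C_4-R_{A_3}C_3B_3^{\dagger}B_4+A_3U_2B_4)A_{22}^{\dagger}+A_4T_4+T_5R_{A_{22}},$$ $$\begin{pmatrix}W_4\\T_1\end{pmatrix}=A_{33}^{\dagger}(E_1-A_{11}W_3A_{44}-B_{44}T_2B_3)-A_{33}^{\dagger}Z_7B_{33}+L_{A_{33}}Z_6,$$ $$(W_5,\ T_3)=R_{A_{33}}(E_1-A_{11}W_3A_{44}-B_{44}T_2B_3)B_{33}^{\dagger}+A_{33}A_{33}^{\dagger}Z_7+Z_8R_{B_{33}},$$ $$W_3=A^{\dagger}EB^{\dagger}-A^{\dagger}CM^{\dagger}EB^{\dagger}-A^{\dagger}SC^{\dagger}EN^{\dagger}DB^{\dagger}-A^{\dagger}SZ_1R_NDB^{\dagger}+L_AZ_2+Z_3R_B,$$ $$T_2=M^{\dagger}ED^{\dagger}+S^{\dagger}SC^{\dagger}EN^{\dagger}+L_ML_SZ_4+L_MZ_1R_N+Z_5R_D.$$ Here $W_4$ and $T_1$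 have as many rows as $A_1$ and $A_3$, respectively, have columns, $W_5$ and $T_3$ have as many columns as $B_2$ and $B_4$, respectively, have rows, and the remaining matrices $W_1,W_2,W_6,T_4,T_5,T_6,Z_1,\dots,Z_8$ are arbitrary matrices over $\mathbb{H}$ of appropriate sizes. That is, for every choice of these parameters the two expressions for $X_3$ agree and $(X_1,\dots,X_5)$ solves $(*)$, and every solution of $(*)$ arises from some choice of them. -/

import Mathlib

open Matrix
open scoped Quaternion

namespace QuaternionSylvester

section MoorePenrose

variable {m n k : Type*} [Fintype m] [Fintype n]

/-- The rank of a quaternion matrix: the dimension of its right column space, i.e. the maximal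
number of right linearly independent columns.  (A right `ℍ[ℝ]`-module is a module over the
opposite ring.) -/
noncomputable def qrank (A : Matrix m n ℍ[ℝ]) : ℕ :=
  Module.finrank (ℍ[ℝ])ᵐᵒᵖ (Submodule.span (ℍ[ℝ])ᵐᵒᵖ (Set.range A.col))

/-- The four Penrose equations. -/
structure IsMoorePenrose (A : Matrix m n ℍ[ℝ]) (X : Matrix n m ℍ[ℝ]) : Prop where
  mul_mul : A * X * A = A
  mul_mul' : X * A * X = X
  left_symm : (A * X)ᴴ = A * X
  right_symm : (X * A)ᴴ = X * A

theorem eq_zero_of_conjTranspose_mul_self {m n : Type*} [Fintype m]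
    (B : Matrix m n ℍ[ℝ]) (h : Bᴴ * B = 0) : B = 0 := by
  ext1 i j
  have h1 : (Bᴴ * B) j j = 0 := by rw [h]; rfl
  rw [Matrix.mul_apply] at h1
  simp only [Matrix.conjTranspose_apply, Quaternion.star_mul_self] at h1
  have h2 : ∑ x, Quaternion.normSq (B x j) = 0 := by
    have h3 : ((∑ x, Quaternion.normSq (B x j) : ℝ) : ℍ[ℝ]) = ((0 : ℝ) : ℍ[ℝ]) := by
      rw [Quaternion.coe_zero, ← h1]
      exact map_sum (algebraMap ℝ ℍ[ℝ]) _ _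
    exact Quaternion.coe_injective h3
  have h4 := (Finset.sum_eq_zero_iff_of_nonneg
    (fun x _ => Quaternion.normSq_nonneg (a := B x j))).1 h2 i (Finset.mem_univ i)
  exact Quaternion.normSq_eq_zero.1 h4

theorem mul_eq_zero_of_conjTranspose_mul (A : Matrix m n ℍ[ℝ]) (X : Matrix n k ℍ[ℝ])
    (h : Aᴴ * A * X = 0) : A * X = 0 := by
  apply eq_zero_of_conjTranspose_mul_self
  rw [Matrix.conjTranspose_mul, Matrix.mul_assoc, ← Matrix.mul_assoc Aᴴ, h, Matrix.mul_zero]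

theorem exists_one_four_inverse (A : Matrix m n ℍ[ℝ]) :
    ∃ G : Matrix n m ℍ[ℝ], A * G * A = A ∧ (G * A)ᴴ = G * A := by
  classical
  set H : Matrix n n ℍ[ℝ] := Aᴴ * A with hH
  have hHs : Hᴴ = H := by simp [hH, Matrix.conjTranspose_mul]
  let T : Matrix n n ℍ[ℝ] →ₗ[ℝ] Matrix n n ℍ[ℝ] := LinearMap.mulLeft ℝ H
  have hk : LinearMap.ker (T ∘ₗ T) = LinearMap.ker T := by
    ext X
    simp only [LinearMap.mem_ker, LinearMap.comp_apply, T, LinearMap.mulLeft_apply]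
    constructor
    · intro h
      apply mul_eq_zero_of_conjTranspose_mul H X
      rw [hHs, Matrix.mul_assoc]; exact h
    · intro h
      rw [h, mul_zero]
  have hr : LinearMap.range (T ∘ₗ T) = LinearMap.range T := by
    apply Submodule.eq_of_le_of_finrank_eq (LinearMap.range_comp_le_range T T)
    have e1 := LinearMap.finrank_range_add_finrank_ker (T ∘ₗ T)
    have e2 := LinearMap.finrank_range_add_finrank_ker T
    rw [hk] at e1
    omega
  have hm : H ∈ LinearMap.range (T ∘ₗ T) := by
    rw [hr]; exact ⟨1, by simp [T]⟩
  obtain ⟨Y, hY⟩ := hm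
  replace hY : H * (H * Y) = H := hY
  have hY' : Yᴴ * H * H = H := by
    have := congrArg Matrix.conjTranspose hY
    simpa [Matrix.conjTranspose_mul, hHs] using this
  have hs : Yᴴ * H = H * Y := by
    calc Yᴴ * H = Yᴴ * (H * (H * Y)) := by rw [hY]
      _ = (Yᴴ * H * H) * Y := by simp only [Matrix.mul_assoc]
      _ = H * Y := by rw [hY']
  refine ⟨Yᴴ * Aᴴ, ?_, ?_⟩
  · have h0 : A * (H * Y - 1) = 0 := by
      apply mul_eq_zero_of_conjTranspose_mul
      rw [← hH, Matrix.mul_sub, hY, Matrix.mul_one, sub_self]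
    rw [Matrix.mul_sub, Matrix.mul_one, sub_eq_zero] at h0
    rw [Matrix.mul_assoc, Matrix.mul_assoc, ← hH, hs, h0]
  · rw [Matrix.mul_assoc, ← hH, Matrix.conjTranspose_mul, hHs, Matrix.conjTranspose_conjTranspose,
      hs]

theorem exists_isMoorePenrose (A : Matrix m n ℍ[ℝ]) : ∃ X, IsMoorePenrose A X := by
  obtain ⟨G, hG1, hG2⟩ := exists_one_four_inverse A
  obtain ⟨K', hK1, hK2⟩ := exists_one_four_inverse Aᴴ
  obtain ⟨K, rfl⟩ : ∃ K, Kᴴ = K' := ⟨K'ᴴ, Matrix.conjTranspose_conjTranspose _⟩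
  replace hK1 : A * K * A = A := by
    have := congrArg Matrix.conjTranspose hK1
    simpa [Matrix.conjTranspose_mul, Matrix.mul_assoc] using this
  replace hK2 : (A * K)ᴴ = A * K := by
    rw [Matrix.conjTranspose_mul, ← hK2, Matrix.conjTranspose_mul]
    simp
  have e1 : A * (G * A * K) = A * K := by
    rw [← Matrix.mul_assoc, ← Matrix.mul_assoc, hG1]
  have e2 : G * A * K * A = G * A := by
    rw [Matrix.mul_assoc G, Matrix.mul_assoc G, hK1]
  refine ⟨G * A * K, ?_, ?_, ?_, ?_⟩
  · rw [e1, hK1]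
  · rw [e2, Matrix.mul_assoc G A K, ← Matrix.mul_assoc (G * A) G, Matrix.mul_assoc G A G,
      Matrix.mul_assoc G (A * G), ← Matrix.mul_assoc (A * G) A K, hG1]
  · rw [e1, hK2]
  · rw [e2, hG2]

theorem IsMoorePenrose.unique {A : Matrix m n ℍ[ℝ]} {X Y : Matrix n m ℍ[ℝ]}
    (hX : IsMoorePenrose A X) (hY : IsMoorePenrose A Y) : X = Y := by
  have h1 : A * X = A * Y := by
    calc A * X = (A * Y * A) * X := by rw [hY.mul_mul]
      _ = (A * Y)ᴴ * (A * X)ᴴ := by rw [hX.left_symm, hY.left_symm, ← Matrix.mul_assoc]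
      _ = (A * X * A * Y)ᴴ := by
        rw [← Matrix.conjTranspose_mul]; simp only [Matrix.mul_assoc]
      _ = A * Y := by rw [hX.mul_mul, hY.left_symm]
  have h2 : X * A = Y * A := by
    calc X * A = X * (A * Y * A) := by rw [hY.mul_mul]
      _ = (X * A)ᴴ * (Y * A)ᴴ := by
        rw [hX.right_symm, hY.right_symm]; simp only [Matrix.mul_assoc]
      _ = (Y * (A * X * A))ᴴ := by
        rw [← Matrix.conjTranspose_mul]; simp only [Matrix.mul_assoc]
      _ = Y * A := by rw [hX.mul_mul, hY.right_symm]
  rw [← hX.mul_mul', ← hY.mul_mul', h2, Matrix.mul_assoc, h1, ← Matrix.mul_assoc]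

/-- The Moore-Penrose inverse. -/
noncomputable def mpInv (A : Matrix m n ℍ[ℝ]) : Matrix n m ℍ[ℝ] :=
  Classical.choose (exists_isMoorePenrose A)

theorem isMoorePenrose_mpInv (A : Matrix m n ℍ[ℝ]) : IsMoorePenrose A (mpInv A) :=
  Classical.choose_spec (exists_isMoorePenrose A)

/-- `L A = I - A† A`. -/
noncomputable def L [DecidableEq n] (A : Matrix m n ℍ[ℝ]) : Matrix n n ℍ[ℝ] := 1 - mpInv A * A

/-- `R A = I - A A†`. -/
noncomputable def R [DecidableEq m] (A : Matrix m n ℍ[ℝ]) : Matrix m m ℍ[ℝ] := 1 - A * mpInv A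

end MoorePenrose

local postfix:1024 "†" => mpInv

/-- The coefficients of the system
`A₁X₁ - X₂B₁ = C₁`, `A₂X₂ - X₃B₂ = C₂`, `A₃X₃ - X₄B₃ = C₃`, `A₄X₅ - X₄B₄ = C₄`,
where the unknown `Xᵢ` has size `aᵢ × bᵢ`. -/
structure Data (a₁ a₂ a₃ a₄ a₅ b₁ b₂ b₃ b₄ b₅ : ℕ) where
  A₁ : Matrix (Fin a₂) (Fin a₁) ℍ[ℝ]
  A₂ : Matrix (Fin a₃) (Fin a₂) ℍ[ℝ]
  A₃ : Matrix (Fin a₄) (Fin a₃) ℍ[ℝ]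
  A₄ : Matrix (Fin a₄) (Fin a₅) ℍ[ℝ]
  B₁ : Matrix (Fin b₂) (Fin b₁) ℍ[ℝ]
  B₂ : Matrix (Fin b₃) (Fin b₂) ℍ[ℝ]
  B₃ : Matrix (Fin b₄) (Fin b₃) ℍ[ℝ]
  B₄ : Matrix (Fin b₄) (Fin b₅) ℍ[ℝ]
  C₁ : Matrix (Fin a₂) (Fin b₁) ℍ[ℝ]
  C₂ : Matrix (Fin a₃) (Fin b₂) ℍ[ℝ]
  C₃ : Matrix (Fin a₄) (Fin b₃) ℍ[ℝ]
  C₄ : Matrix (Fin a₄) (Fin b₅) ℍ[ℝ]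

/-- The free parameters of the general solution. -/
structure Params (a₁ a₂ a₃ a₄ a₅ b₁ b₂ b₃ b₄ b₅ : ℕ) where
  W₁ : Matrix (Fin a₁) (Fin b₁) ℍ[ℝ]
  W₂ : Matrix (Fin a₂) (Fin b₂) ℍ[ℝ]
  W₆ : Matrix (Fin a₁) (Fin b₂) ℍ[ℝ]
  T₄ : Matrix (Fin a₅) (Fin b₄) ℍ[ℝ]
  T₅ : Matrix (Fin a₄) (Fin b₄) ℍ[ℝ]
  T₆ : Matrix (Fin a₅) (Fin b₅) ℍ[ℝ]
  Z₁ : Matrix (Fin a₃) (Fin b₄) ℍ[ℝ]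
  Z₂ : Matrix (Fin a₂) (Fin b₂) ℍ[ℝ]
  Z₃ : Matrix (Fin a₂) (Fin b₂) ℍ[ℝ]
  Z₄ : Matrix (Fin a₃) (Fin b₄) ℍ[ℝ]
  Z₅ : Matrix (Fin a₃) (Fin b₄) ℍ[ℝ]
  Z₆ : Matrix (Fin a₁ ⊕ Fin a₃) (Fin b₃) ℍ[ℝ]
  Z₇ : Matrix (Fin a₃) (Fin b₃ ⊕ Fin b₄) ℍ[ℝ]
  Z₈ : Matrix (Fin a₃) (Fin b₃ ⊕ Fin b₄) ℍ[ℝ]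

namespace Data

variable {a₁ a₂ a₃ a₄ a₅ b₁ b₂ b₃ b₄ b₅ : ℕ} (d : Data a₁ a₂ a₃ a₄ a₅ b₁ b₂ b₃ b₄ b₅)

/-- `(X₁, …, X₅)` solves the system. -/
def IsSolution (X₁ : Matrix (Fin a₁) (Fin b₁) ℍ[ℝ]) (X₂ : Matrix (Fin a₂) (Fin b₂) ℍ[ℝ])
    (X₃ : Matrix (Fin a₃) (Fin b₃) ℍ[ℝ]) (X₄ : Matrix (Fin a₄) (Fin b₄) ℍ[ℝ])
    (X₅ : Matrix (Fin a₅) (Fin b₅) ℍ[ℝ]) : Prop :=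
  d.A₁ * X₁ - X₂ * d.B₁ = d.C₁ ∧
  d.A₂ * X₂ - X₃ * d.B₂ = d.C₂ ∧
  d.A₃ * X₃ - X₄ * d.B₃ = d.C₃ ∧
  d.A₄ * X₅ - X₄ * d.B₄ = d.C₄

/-- The system has a solution. -/
def Consistent : Prop := ∃ X₁ X₂ X₃ X₄ X₅, d.IsSolution X₁ X₂ X₃ X₄ X₅

/-- The rank equalities; `fromCols` and `fromBlocks` build the block matrices. -/
def RankConditions : Prop :=
  qrank (fromBlocks d.C₁ d.A₁ d.B₁ 0) = qrank d.A₁ + qrank d.B₁ ∧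
  qrank (fromBlocks d.C₂ d.A₂ d.B₂ 0) = qrank d.A₂ + qrank d.B₂ ∧
  qrank (fromBlocks d.C₃ d.A₃ d.B₃ 0) = qrank d.A₃ + qrank d.B₃ ∧
  qrank (fromBlocks d.C₄ d.A₄ d.B₄ 0) = qrank d.A₄ + qrank d.B₄ ∧
  qrank (fromBlocks (d.A₂ * d.C₁ + d.C₂ * d.B₁) (d.A₂ * d.A₁) (d.B₂ * d.B₁) 0)
    = qrank (d.A₂ * d.A₁) + qrank (d.B₂ * d.B₁) ∧
  qrank (fromBlocks (fromCols d.C₃ d.C₄) (fromCols d.A₃ d.A₄) (fromCols d.B₃ d.B₄) 0)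
    = qrank (fromCols d.A₃ d.A₄) + qrank (fromCols d.B₃ d.B₄) ∧
  qrank (fromBlocks (fromCols (d.A₃ * d.C₂ + d.C₃ * d.B₂) d.C₄) (fromCols (d.A₃ * d.A₂) d.A₄)
      (fromCols (d.B₃ * d.B₂) d.B₄) 0)
    = qrank (fromCols (d.A₃ * d.A₂) d.A₄) + qrank (fromCols (d.B₃ * d.B₂) d.B₄) ∧
  qrank (fromBlocks (d.A₃ * d.A₂ * d.C₁ + d.A₃ * d.C₂ * d.B₁ + d.C₃ * d.B₂ * d.B₁)
      (d.A₃ * d.A₂ * d.A₁) (d.B₃ * d.B₂ * d.B₁) 0)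
    = qrank (d.A₃ * d.A₂ * d.A₁) + qrank (d.B₃ * d.B₂ * d.B₁) ∧
  qrank (fromBlocks (d.A₃ * d.C₂ + d.C₃ * d.B₂) (d.A₃ * d.A₂) (d.B₃ * d.B₂) 0)
    = qrank (d.A₃ * d.A₂) + qrank (d.B₃ * d.B₂) ∧
  qrank (fromBlocks
      (fromCols (d.A₃ * d.A₂ * d.C₁ + d.A₃ * d.C₂ * d.B₁ + d.C₃ * d.B₂ * d.B₁) d.C₄)
      (fromCols d.A₄ (d.A₃ * d.A₂ * d.A₁))
      (fromCols (d.B₃ * d.B₂ * d.B₁) d.B₄) 0)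
    = qrank (fromCols (d.A₃ * d.A₂ * d.A₁) d.A₄) + qrank (fromCols (d.B₃ * d.B₂ * d.B₁) d.B₄)

noncomputable def A₁₁ : Matrix (Fin a₃) (Fin a₂) ℍ[ℝ] := R (d.A₂ * d.A₁) * d.A₂

noncomputable def B₁₁ : Matrix (Fin b₂) (Fin b₂) ℍ[ℝ] := R d.B₁ * L d.B₂

noncomputable def C₁₁ : Matrix (Fin a₃) (Fin b₂) ℍ[ℝ] :=
  R (d.A₂ * d.A₁) * (d.A₂ * R d.A₁ * d.C₁ * d.B₁† + d.C₂) * L d.B₂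

noncomputable def A₂₂ : Matrix (Fin b₄) (Fin b₅) ℍ[ℝ] := R d.B₃ * d.B₄

noncomputable def B₂₂ : Matrix (Fin a₄) (Fin a₃) ℍ[ℝ] := R d.A₄ * d.A₃

noncomputable def C₂₂ : Matrix (Fin b₄) (Fin b₅) ℍ[ℝ] := d.B₄ * L d.A₂₂

noncomputable def D₂₂ : Matrix (Fin a₄) (Fin b₅) ℍ[ℝ] :=
  R d.A₄ * (R d.A₃ * d.C₃ * d.B₃† * d.B₄ - d.C₄) * L d.A₂₂

noncomputable def A₃₃ : Matrix (Fin a₃) (Fin a₁ ⊕ Fin a₃) ℍ[ℝ] :=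
  fromCols (d.A₂ * d.A₁) (-L d.A₃)

noncomputable def B₃₃ : Matrix (Fin b₃ ⊕ Fin b₄) (Fin b₃) ℍ[ℝ] :=
  fromRows (R d.B₂) (-(R d.C₂₂ * d.B₃))

noncomputable def A₄₄ : Matrix (Fin b₂) (Fin b₃) ℍ[ℝ] := R d.B₁₁ * R d.B₁ * d.B₂†

noncomputable def B₄₄ : Matrix (Fin a₃) (Fin a₃) ℍ[ℝ] := -L d.B₂₂

noncomputable def E₁ : Matrix (Fin a₃) (Fin b₃) ℍ[ℝ] :=
  d.A₃† * d.C₃ + d.B₂₂† * d.D₂₂ * d.C₂₂† * d.B₃ + R (d.A₂ * d.A₁) * d.C₂ * d.B₂†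
    + d.A₁₁ * R d.A₁ * d.C₁ * d.B₁† * d.B₂† - d.C₁₁ * d.B₁₁† * R d.B₁ * d.B₂†

noncomputable def A : Matrix (Fin a₃) (Fin a₂) ℍ[ℝ] := R d.A₃₃ * d.A₁₁

noncomputable def B : Matrix (Fin b₂) (Fin b₃) ℍ[ℝ] := d.A₄₄ * L d.B₃₃

noncomputable def C : Matrix (Fin a₃) (Fin a₃) ℍ[ℝ] := R d.A₃₃ * d.B₄₄

noncomputable def D : Matrix (Fin b₄) (Fin b₃) ℍ[ℝ] := d.B₃ * L d.B₃₃

noncomputable def E : Matrix (Fin a₃) (Fin b₃) ℍ[ℝ] := R d.A₃₃ * d.E₁ * L d.B₃₃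

noncomputable def M : Matrix (Fin a₃) (Fin a₃) ℍ[ℝ] := R d.A * d.C

noncomputable def N : Matrix (Fin b₄) (Fin b₃) ℍ[ℝ] := d.D * L d.B

noncomputable def S : Matrix (Fin a₃) (Fin a₃) ℍ[ℝ] := d.C * L d.M

/-- The conditions in terms of the Moore-Penrose projectors. -/
def ProjectorConditions : Prop :=
  R d.A₁ * d.C₁ * L d.B₁ = 0 ∧ R d.A₁₁ * d.C₁₁ = 0 ∧ d.C₁₁ * L d.B₁₁ = 0 ∧
  R d.A₃ * d.C₃ * L d.B₃ = 0 ∧ R d.B₂₂ * d.D₂₂ = 0 ∧ d.D₂₂ * L d.C₂₂ = 0 ∧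
  R d.M * R d.A * d.E = 0 ∧ d.E * L d.B * L d.N = 0 ∧
  R d.A * d.E * L d.D = 0 ∧ R d.C * d.E * L d.B = 0

variable (p : Params a₁ a₂ a₃ a₄ a₅ b₁ b₂ b₃ b₄ b₅)

noncomputable def W₃ : Matrix (Fin a₂) (Fin b₂) ℍ[ℝ] :=
  d.A† * d.E * d.B† - d.A† * d.C * d.M† * d.E * d.B†
    - d.A† * d.S * d.C† * d.E * d.N† * d.D * d.B†
    - d.A† * d.S * p.Z₁ * R d.N * d.D * d.B† + L d.A * p.Z₂ + p.Z₃ * R d.B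

noncomputable def T₂ : Matrix (Fin a₃) (Fin b₄) ℍ[ℝ] :=
  d.M† * d.E * d.D† + d.S† * d.S * d.C† * d.E * d.N† + L d.M * L d.S * p.Z₄
    + L d.M * p.Z₁ * R d.N + p.Z₅ * R d.D

/-- The block column `(W₄; T₁)`. -/
noncomputable def colBlock : Matrix (Fin a₁ ⊕ Fin a₃) (Fin b₃) ℍ[ℝ] :=
  d.A₃₃† * (d.E₁ - d.A₁₁ * d.W₃ p * d.A₄₄ - d.B₄₄ * d.T₂ p * d.B₃)
    - d.A₃₃† * p.Z₇ * d.B₃₃ + L d.A₃₃ * p.Z₆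

/-- The block row `(W₅, T₃)`. -/
noncomputable def rowBlock : Matrix (Fin a₃) (Fin b₃ ⊕ Fin b₄) ℍ[ℝ] :=
  R d.A₃₃ * (d.E₁ - d.A₁₁ * d.W₃ p * d.A₄₄ - d.B₄₄ * d.T₂ p * d.B₃) * d.B₃₃†
    + d.A₃₃ * d.A₃₃† * p.Z₇ + p.Z₈ * R d.B₃₃

noncomputable def W₄ : Matrix (Fin a₁) (Fin b₃) ℍ[ℝ] := (d.colBlock p).toRows₁

noncomputable def T₁ : Matrix (Fin a₃) (Fin b₃) ℍ[ℝ] := (d.colBlock p).toRows₂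

noncomputable def W₅ : Matrix (Fin a₃) (Fin b₃) ℍ[ℝ] := (d.rowBlock p).toCols₁

noncomputable def T₃ : Matrix (Fin a₃) (Fin b₄) ℍ[ℝ] := (d.rowBlock p).toCols₂

noncomputable def V₁ : Matrix (Fin a₂) (Fin b₂) ℍ[ℝ] :=
  d.A₁₁† * d.C₁₁ * d.B₁₁† + L d.A₁₁ * p.W₂ + d.W₃ p * R d.B₁₁

noncomputable def U₁ : Matrix (Fin a₁) (Fin b₂) ℍ[ℝ] :=
  (d.A₂ * d.A₁)† * (d.C₂ + d.A₂ * R d.A₁ * d.C₁ * d.B₁† - d.A₂ * d.V₁ p * R d.B₁)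
    + d.W₄ p * d.B₂ + L (d.A₂ * d.A₁) * p.W₆

noncomputable def U₂ : Matrix (Fin a₃) (Fin b₄) ℍ[ℝ] :=
  d.B₂₂† * d.D₂₂ * d.C₂₂† + L d.B₂₂ * d.T₂ p + d.T₃ p * R d.C₂₂

noncomputable def V₂ : Matrix (Fin a₄) (Fin b₄) ℍ[ℝ] :=
  -(R d.A₄ * (d.C₄ - R d.A₃ * d.C₃ * d.B₃† * d.B₄ + d.A₃ * d.U₂ p * d.B₄) * d.A₂₂†)
    + d.A₄ * p.T₄ + p.T₅ * R d.A₂₂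

noncomputable def X₁ : Matrix (Fin a₁) (Fin b₁) ℍ[ℝ] :=
  d.A₁† * d.C₁ + d.U₁ p * d.B₁ + L d.A₁ * p.W₁

noncomputable def X₂ : Matrix (Fin a₂) (Fin b₂) ℍ[ℝ] :=
  -(R d.A₁ * d.C₁ * d.B₁†) + d.A₁ * d.U₁ p + d.V₁ p * R d.B₁

/-- The first expression for the third unknown. -/
noncomputable def X₃ : Matrix (Fin a₃) (Fin b₃) ℍ[ℝ] :=
  -(R (d.A₂ * d.A₁) * (d.C₂ + d.A₂ * R d.A₁ * d.C₁ * d.B₁† - d.A₂ * d.V₁ p * R d.B₁) * d.B₂†)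
    + d.A₂ * d.A₁ * d.W₄ p + d.W₅ p * R d.B₂

/-- The second expression for the third unknown. -/
noncomputable def X₃' : Matrix (Fin a₃) (Fin b₃) ℍ[ℝ] :=
  d.A₃† * d.C₃ + d.U₂ p * d.B₃ + L d.A₃ * d.T₁ p

noncomputable def X₄ : Matrix (Fin a₄) (Fin b₄) ℍ[ℝ] :=
  -(R d.A₃ * d.C₃ * d.B₃†) + d.A₃ * d.U₂ p + d.V₂ p * R d.B₃

noncomputable def X₅ : Matrix (Fin a₅) (Fin b₅) ℍ[ℝ] :=
  d.A₄† * (d.C₄ - R d.A₃ * d.C₃ * d.B₃† * d.B₄ + d.A₃ * d.U₂ p * d.B₄)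
    + p.T₄ * d.A₂₂ + L d.A₄ * p.T₆

end Data

end QuaternionSylvester

/-! Everything rests on one equation: A X - Y B = C is solvable iff R_A C L_B = 0, with an explicit
general solution (`mul_sub_mul_eq_iff`). The condition says that C maps the null space of B into the
column space of A, which is also what the rank equality for the block matrix (C A; B 0) says
(`qrank_fromBlocks_eq_iff`).

The system is a chain, cut at X₃. Solving the first two equations, and separately the last two, by
successive elimination gives two expressions for X₃ with free parameters (`first_half_iff`,
`second_half_iff`). Equating them gives a linear equation in the block unknowns (W₄; T₁) and (W₅,
T₃); its solvability condition is A W₃ B + C T₂ D = E, solved by `mul_mul_add_mul_mul_eq_iff`. Every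
step is an equivalence, so the projector conditions and the general solution come out together.

For the rank equalities, necessity holds because each one is the solvability condition of a single
equation A X - Y B = C deduced from the system by telescoping products or by juxtaposing equations
that share X₄. Conversely, E₁ is the difference of two particular values of X₃, one from each half.
The remaining conditions have the form J E₁ K = 0; factoring J through A₃ and K through B₂ or B₂B₁
turns J E₁ K into a product that one of the rank conditions kills
(`RankConditions.twoTermConditions`). -/

namespace QuaternionSylvester

/-! ### Identities for Moore–Penrose inverses and their projectors -/

section MoorePenroseLemmas

variable {m n k o p q r : Type*} [Fintype m] [Fintype n]

theorem mul_mpInv_mul (A : Matrix m n ℍ[ℝ]) : A * (mpInv A * A) = A := by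
  rw [← Matrix.mul_assoc, (isMoorePenrose_mpInv A).mul_mul]

theorem mpInv_mul_mpInv (A : Matrix m n ℍ[ℝ]) : mpInv A * (A * mpInv A) = mpInv A := by
  rw [← Matrix.mul_assoc, (isMoorePenrose_mpInv A).mul_mul']

theorem mul_mpInv_mul_assoc (A : Matrix m n ℍ[ℝ]) (X : Matrix n q ℍ[ℝ]) :
    A * (mpInv A * (A * X)) = A * X := by
  rw [← Matrix.mul_assoc, ← Matrix.mul_assoc, (isMoorePenrose_mpInv A).mul_mul]

theorem mpInv_mul_mpInv_assoc (A : Matrix m n ℍ[ℝ]) (X : Matrix m q ℍ[ℝ]) :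
    mpInv A * (A * (mpInv A * X)) = mpInv A * X := by
  rw [← Matrix.mul_assoc, ← Matrix.mul_assoc, (isMoorePenrose_mpInv A).mul_mul']

theorem R_mul_self [DecidableEq m] (A : Matrix m n ℍ[ℝ]) : R A * A = 0 := by
  rw [R, Matrix.sub_mul, Matrix.mul_assoc, mul_mpInv_mul, Matrix.one_mul, sub_self]

theorem mul_L_self [DecidableEq n] (A : Matrix m n ℍ[ℝ]) : A * L A = 0 := by
  rw [L, Matrix.mul_sub, mul_mpInv_mul, Matrix.mul_one, sub_self]

theorem R_mul_self_assoc [DecidableEq m] (A : Matrix m n ℍ[ℝ]) (X : Matrix n q ℍ[ℝ]) :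
    R A * (A * X) = 0 := by
  rw [← Matrix.mul_assoc, R_mul_self, Matrix.zero_mul]

theorem mul_L_self_assoc [DecidableEq n] (A : Matrix m n ℍ[ℝ]) (X : Matrix n q ℍ[ℝ]) :
    A * (L A * X) = 0 := by
  rw [← Matrix.mul_assoc, mul_L_self, Matrix.zero_mul]

theorem mul_R_of_mul_eq_zero [DecidableEq m] {G : Matrix q m ℍ[ℝ]} {A : Matrix m n ℍ[ℝ]}
    (h : G * A = 0) :
    G * R A = G := by
  rw [R, Matrix.mul_sub, ← Matrix.mul_assoc, h, Matrix.zero_mul, Matrix.mul_one, sub_zero]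

theorem L_mul_of_mul_eq_zero [DecidableEq n] {B : Matrix m n ℍ[ℝ]} {Y : Matrix n q ℍ[ℝ]}
    (h : B * Y = 0) :
    L B * Y = Y := by
  rw [L, Matrix.sub_mul, Matrix.mul_assoc, h, Matrix.mul_zero, Matrix.one_mul, sub_zero]

theorem mul_mpInv_mul_of_R_mul [DecidableEq m] {A : Matrix m n ℍ[ℝ]} {C : Matrix m r ℍ[ℝ]}
    (h : R A * C = 0) :
    A * (mpInv A * C) = C := by
  rw [R, Matrix.sub_mul, Matrix.one_mul, sub_eq_zero, Matrix.mul_assoc] at h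
  exact h.symm

theorem mul_mpInv_mul_of_mul_L [DecidableEq n] {B : Matrix m n ℍ[ℝ]} {C : Matrix q n ℍ[ℝ]}
    (h : C * L B = 0) :
    C * (mpInv B * B) = C := by
  rw [L, Matrix.mul_sub, Matrix.mul_one, sub_eq_zero] at h
  exact h.symm

/-- The form in which rank conditions are used: G absorbs R_A and Y absorbs L_B, so any left
annihilator of A and right annihilator of B may replace the projectors. -/
theorem mul_mul_eq_zero_of_annihilates [Fintype k] [Fintype o] [DecidableEq m]
    [DecidableEq o] {A : Matrix m n ℍ[ℝ]} {B : Matrix k o ℍ[ℝ]} {C : Matrix m o ℍ[ℝ]}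
    (h : R A * C * L B = 0) {G : Matrix q m ℍ[ℝ]} {Y : Matrix o r ℍ[ℝ]}
    (hG : G * A = 0) (hY : B * Y = 0) : G * C * Y = 0 := by
  calc G * C * Y = (G * R A) * C * (L B * Y) := by
        rw [mul_R_of_mul_eq_zero hG, L_mul_of_mul_eq_zero hY]
    _ = G * (R A * C * L B) * Y := by simp only [Matrix.mul_assoc]
    _ = 0 := by rw [h, Matrix.mul_zero, Matrix.zero_mul]

theorem conjTranspose_R [DecidableEq m] (A : Matrix m n ℍ[ℝ]) : (R A)ᴴ = R A := by
  rw [R, Matrix.conjTranspose_sub, (isMoorePenrose_mpInv A).left_symm, Matrix.conjTranspose_one]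

theorem conjTranspose_L [DecidableEq n] (A : Matrix m n ℍ[ℝ]) : (L A)ᴴ = L A := by
  rw [L, Matrix.conjTranspose_sub, (isMoorePenrose_mpInv A).right_symm, Matrix.conjTranspose_one]

theorem R_mul_R [DecidableEq m] (A : Matrix m n ℍ[ℝ]) : R A * R A = R A :=
  mul_R_of_mul_eq_zero (R_mul_self A)

theorem L_mul_L [DecidableEq n] (A : Matrix m n ℍ[ℝ]) : L A * L A = L A :=
  L_mul_of_mul_eq_zero (mul_L_self A)

/-- Taking adjoints in P(MM†) = MM† moves the Hermitian P to the right of MM†; then M† = M†MM†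
absorbs it. -/
theorem mpInv_mul_eq_of_mul_eq {P : Matrix m m ℍ[ℝ]} (hP : Pᴴ = P) {M : Matrix m n ℍ[ℝ]}
    (h : P * M = M) : mpInv M * P = mpInv M := by
  have h1 : M * mpInv M * P = M * mpInv M := by
    have := congrArg conjTranspose (congrArg (· * mpInv M) h)
    simp only [Matrix.mul_assoc] at this
    rw [conjTranspose_mul, (isMoorePenrose_mpInv M).left_symm, hP] at this
    exact this
  calc mpInv M * P = mpInv M * (M * mpInv M * P) := by
        simp only [Matrix.mul_assoc, mpInv_mul_mpInv_assoc]
    _ = mpInv M := by rw [h1, mpInv_mul_mpInv]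

theorem mul_mpInv_eq_of_mul_eq {P : Matrix n n ℍ[ℝ]} (hP : Pᴴ = P) {M : Matrix m n ℍ[ℝ]}
    (h : M * P = M) : P * mpInv M = mpInv M := by
  have h1 : P * (mpInv M * M) = mpInv M * M := by
    have := congrArg conjTranspose (congrArg (mpInv M * ·) h)
    simp only [← Matrix.mul_assoc] at this
    rw [conjTranspose_mul, (isMoorePenrose_mpInv M).right_symm, hP] at this
    exact this
  calc P * mpInv M = P * (mpInv M * M) * mpInv M := by
        simp only [Matrix.mul_assoc, mpInv_mul_mpInv]
    _ = mpInv M := by rw [h1, Matrix.mul_assoc, mpInv_mul_mpInv]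

theorem mpInv_R_mul_mul_R [Fintype k] [DecidableEq m] (A : Matrix m n ℍ[ℝ]) (C : Matrix m k ℍ[ℝ]) :
    mpInv (R A * C) * R A = mpInv (R A * C) :=
  mpInv_mul_eq_of_mul_eq (conjTranspose_R A) (by rw [← Matrix.mul_assoc, R_mul_R])

theorem L_mul_mpInv_mul_L [Fintype k] [DecidableEq n] (B : Matrix m n ℍ[ℝ]) (D : Matrix k n ℍ[ℝ]) :
    L B * mpInv (D * L B) = mpInv (D * L B) :=
  mul_mpInv_eq_of_mul_eq (conjTranspose_L B) (by rw [Matrix.mul_assoc, L_mul_L])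

/-! ### Linear matrix equations with one coefficient pair -/

variable [Fintype k] [Fintype o] [DecidableEq m] [DecidableEq n] [DecidableEq k] [DecidableEq o]

/-- The general solution of `A X - Y B = C`. -/
theorem mul_sub_mul_eq_iff (A : Matrix m n ℍ[ℝ]) (B : Matrix k o ℍ[ℝ]) (C : Matrix m o ℍ[ℝ])
    (X : Matrix n o ℍ[ℝ]) (Y : Matrix m k ℍ[ℝ]) :
    A * X - Y * B = C ↔ R A * C * L B = 0 ∧ ∃ (U : Matrix n k ℍ[ℝ])
      (V : Matrix m k ℍ[ℝ]) (W : Matrix n o ℍ[ℝ]),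
      X = mpInv A * C + U * B + L A * W ∧ Y = -(R A * C * mpInv B) + A * U + V * R B := by
  constructor
  · rintro rfl
    -- A given solution is recovered from its splittings X = A†AX + L_A X and Y = AA†Y + R_A Y, the
    -- last term being split again by BB† and R_B.
    refine ⟨?_, mpInv A * Y, R A * Y, X, ?_, ?_⟩
    · simp only [Matrix.mul_sub, Matrix.sub_mul, R_mul_self_assoc, Matrix.mul_assoc, mul_L_self,
        Matrix.mul_zero, sub_zero, Matrix.zero_mul]
    · simp only [L, Matrix.mul_sub, Matrix.sub_mul, Matrix.mul_assoc, Matrix.one_mul]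
      abel
    · simp only [Matrix.mul_sub, Matrix.sub_mul, R_mul_self_assoc, Matrix.mul_assoc,
        Matrix.zero_mul]
      simp only [R, Matrix.mul_sub, Matrix.sub_mul, Matrix.mul_assoc, Matrix.one_mul,
        Matrix.mul_one]
      abel
  · rintro ⟨h, U, V, W, rfl, rfl⟩
    have h' := mul_mpInv_mul_of_mul_L h
    simp only [R, Matrix.sub_mul, Matrix.mul_assoc, Matrix.one_mul] at h'
    simp only [R, L, Matrix.mul_add, Matrix.add_mul, Matrix.mul_sub, Matrix.sub_mul,
      Matrix.mul_assoc, Matrix.one_mul, Matrix.mul_one, Matrix.neg_mul, mul_mpInv_mul,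
      mul_mpInv_mul_assoc, h']
    abel

/-- The general solution of `A X B = C`. -/
theorem mul_mul_eq_iff (A : Matrix m n ℍ[ℝ]) (B : Matrix k o ℍ[ℝ]) (C : Matrix m o ℍ[ℝ])
    (X : Matrix n k ℍ[ℝ]) :
    A * X * B = C ↔ (R A * C = 0 ∧ C * L B = 0) ∧ ∃ U V : Matrix n k ℍ[ℝ],
      X = mpInv A * C * mpInv B + L A * U + V * R B := by
  constructor
  · rintro rfl
    refine ⟨⟨?_, ?_⟩, X, mpInv A * (A * X), ?_⟩
    · simp only [Matrix.mul_assoc, R_mul_self_assoc]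
    · simp only [Matrix.mul_assoc, mul_L_self, Matrix.mul_zero]
    · simp only [L, R, Matrix.mul_sub, Matrix.sub_mul, Matrix.mul_assoc, Matrix.one_mul,
        Matrix.mul_one]
      abel
  · rintro ⟨⟨h1, h2⟩, U, V, rfl⟩
    simp only [Matrix.mul_add, Matrix.add_mul, Matrix.mul_assoc, mul_L_self_assoc, R_mul_self,
      Matrix.mul_zero, add_zero, mul_mpInv_mul_of_mul_L h2, mul_mpInv_mul_of_R_mul h1]

/-- The general solution of `A X + Y B = H`. -/
theorem mul_add_mul_eq_iff (A : Matrix m n ℍ[ℝ]) (B : Matrix k o ℍ[ℝ]) (H : Matrix m o ℍ[ℝ])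
    (X : Matrix n o ℍ[ℝ]) (Y : Matrix m k ℍ[ℝ]) :
    A * X + Y * B = H ↔ R A * H * L B = 0 ∧ ∃ (Z₆ : Matrix n o ℍ[ℝ])
      (Z₇ Z₈ : Matrix m k ℍ[ℝ]),
      X = mpInv A * H - mpInv A * Z₇ * B + L A * Z₆ ∧
      Y = R A * H * mpInv B + A * mpInv A * Z₇ + Z₈ * R B := by
  constructor
  · rintro rfl
    refine ⟨?_, X, Y, R A * Y, ?_, ?_⟩
    · simp only [Matrix.mul_add, Matrix.add_mul, R_mul_self_assoc, Matrix.mul_assoc, mul_L_self,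
        Matrix.mul_zero, add_zero, Matrix.zero_mul]
    · simp only [L, Matrix.mul_add, Matrix.sub_mul, Matrix.mul_assoc, Matrix.one_mul]
      abel
    · simp only [Matrix.mul_add, Matrix.add_mul, R_mul_self_assoc, Matrix.mul_assoc,
        Matrix.zero_mul]
      simp only [R, Matrix.mul_sub, Matrix.sub_mul, Matrix.mul_assoc, Matrix.one_mul,
        Matrix.mul_one]
      abel
  · rintro ⟨h, Z₆, Z₇, Z₈, rfl, rfl⟩
    have h' := mul_mpInv_mul_of_mul_L h
    simp only [R, Matrix.sub_mul, Matrix.mul_assoc, Matrix.one_mul] at h'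
    simp only [R, L, Matrix.mul_add, Matrix.add_mul, Matrix.mul_sub, Matrix.sub_mul,
      Matrix.mul_assoc, Matrix.one_mul, Matrix.mul_one, mul_mpInv_mul,
      mul_mpInv_mul_assoc, h']
    abel

/-! ### The equation A X B + C Y D = E -/

section TwoTerm

set_option linter.unusedSectionVars false

variable (A : Matrix m n ℍ[ℝ]) (B : Matrix k o ℍ[ℝ]) [Fintype p] [Fintype r]
  [DecidableEq p] [DecidableEq r]
  (C : Matrix m p ℍ[ℝ]) (D : Matrix r o ℍ[ℝ]) (E : Matrix m o ℍ[ℝ])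

/-- `A X B + C Y D = E` as a pair of equations for `Y` and the general solution for `X`. -/
theorem mul_mul_add_mul_mul_eq_iff_aux (X : Matrix n k ℍ[ℝ]) (Y : Matrix p r ℍ[ℝ]) :
    A * X * B + C * Y * D = E ↔
      (R A * C * Y * D = R A * E ∧ C * Y * (D * L B) = E * L B) ∧
      ∃ U V : Matrix n k ℍ[ℝ],
        X = mpInv A * (E - C * Y * D) * mpInv B + L A * U + V * R B := by
  rw [← eq_sub_iff_add_eq, mul_mul_eq_iff, Matrix.mul_sub, Matrix.sub_mul, sub_eq_zero,
    sub_eq_zero]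
  simp only [Matrix.mul_assoc, eq_comm]

/-- The solvability conditions of `A X B + C Y D = E`. -/
def TwoTermConditions : Prop :=
  R (R A * C) * R A * E = 0 ∧ E * L B * L (D * L B) = 0 ∧ R A * E * L D = 0 ∧ R C * E * L B = 0

variable {A B C D E}

theorem TwoTermConditions.of_eq {Y : Matrix p r ℍ[ℝ]} (h1 : R A * C * Y * D = R A * E)
    (h2 : C * Y * (D * L B) = E * L B) : TwoTermConditions A B C D E := by
  refine ⟨?_, ?_, ?_, ?_⟩
  · rw [Matrix.mul_assoc, ← h1, Matrix.mul_assoc _ Y D, R_mul_self_assoc]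
  · rw [← h2, Matrix.mul_assoc _ (D * L B), mul_L_self, Matrix.mul_zero]
  · rw [← h1, Matrix.mul_assoc _ D, mul_L_self, Matrix.mul_zero]
  · rw [Matrix.mul_assoc, ← h2, Matrix.mul_assoc, R_mul_self_assoc]

variable {M : Matrix m p ℍ[ℝ]} {N : Matrix r o ℍ[ℝ]} {S : Matrix m p ℍ[ℝ]}

/-- Since S = C L_M, its inverse satisfies S† = L_M S†, so C acts on S† as S does. -/
theorem mul_mpInv_mul_of_eq_mul_L (hS : S = C * L M) : C * (mpInv S * S) = S := by
  have h : L M * mpInv S = mpInv S := hS ▸ L_mul_mpInv_mul_L M C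
  rw [← h, ← Matrix.mul_assoc, ← Matrix.mul_assoc, ← hS, Matrix.mul_assoc, mul_mpInv_mul]

/-- M† absorbs R_A, so E may be replaced by R_A E, which D†D fixes because R_A E L_D = 0. -/
theorem mpInv_mul_E_mul_mpInv_mul (hM : M = R A * C) (h : TwoTermConditions A B C D E) :
    mpInv M * (E * (mpInv D * D)) = mpInv M * E := by
  have e : mpInv M * R A = mpInv M := hM ▸ mpInv_R_mul_mul_R A C
  rw [← e, Matrix.mul_assoc, Matrix.mul_assoc, ← Matrix.mul_assoc (R A) E,
    mul_mpInv_mul_of_mul_L h.2.2.1]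

/-- The product `C Y D` for the general solution `Y`. -/
theorem mul_general_mul (hM : M = R A * C) (hS : S = C * L M)
    (h : TwoTermConditions A B C D E) (Z₁ Z₄ Z₅ : Matrix p r ℍ[ℝ]) :
    C * (mpInv M * E * mpInv D + mpInv S * S * mpInv C * E * mpInv N + L M * L S * Z₄
      + L M * Z₁ * R N + Z₅ * R D) * D
      = C * mpInv M * E + S * mpInv C * E * mpInv N * D + S * Z₁ * R N * D := by
  have h1 := mpInv_mul_E_mul_mpInv_mul hM h
  have h2 : ∀ T : Matrix p o ℍ[ℝ], C * (mpInv S * (S * T)) = S * T := fun T => by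
    rw [← Matrix.mul_assoc (mpInv S), ← Matrix.mul_assoc, mul_mpInv_mul_of_eq_mul_L hS]
  have h3 : ∀ T : Matrix p o ℍ[ℝ], C * (L M * T) = S * T := fun T => by
    rw [← Matrix.mul_assoc, hS]
  simp only [Matrix.mul_add, Matrix.add_mul, Matrix.mul_assoc, h1, h2, h3, R_mul_self,
    mul_L_self_assoc, Matrix.mul_zero, add_zero]

/-- The general solution of the pair `M Y D = R A * E`, `C Y N = E * L B`. -/
theorem pair_iff (hM : M = R A * C) (hN : N = D * L B) (hS : S = C * L M)
    (h : TwoTermConditions A B C D E) (Y : Matrix p r ℍ[ℝ]) :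
    (R A * C * Y * D = R A * E ∧ C * Y * (D * L B) = E * L B) ↔ ∃ Z₁ Z₄ Z₅ : Matrix p r ℍ[ℝ],
      Y = mpInv M * E * mpInv D + mpInv S * S * mpInv C * E * mpInv N + L M * L S * Z₄
      + L M * Z₁ * R N + Z₅ * R D := by
  have eM : mpInv M * R A = mpInv M := hM ▸ mpInv_R_mul_mul_R A C
  have eN : L B * mpInv N = mpInv N := hN ▸ L_mul_mpInv_mul_L B D
  have eS : L M * mpInv S = mpInv S := hS ▸ L_mul_mpInv_mul_L M C
  constructor
  · rintro ⟨h1, h2⟩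
    have f1 : mpInv M * E * mpInv D = mpInv M * M * Y * D * mpInv D := by
      have : mpInv M * (M * Y * D) = mpInv M * E := by
        rw [hM, h1, ← hM, ← Matrix.mul_assoc, eM]
      rw [← this]
      simp only [Matrix.mul_assoc]
    have f2 : mpInv S * S * mpInv C * E * mpInv N = mpInv S * S * Y * N * mpInv N := by
      have g1 : S * (mpInv C * C) = S := by
        have : mpInv M * M = mpInv M * C := by rw [hM, ← Matrix.mul_assoc, ← hM, eM]
        rw [hS, L, this]
        simp only [Matrix.mul_sub, Matrix.sub_mul, Matrix.mul_assoc, mul_mpInv_mul,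
          Matrix.mul_one]
      have g2 : E * mpInv N = C * Y * N * mpInv N := by
        rw [← eN, ← Matrix.mul_assoc, ← h2, ← hN]
        simp only [Matrix.mul_assoc, eN]
      rw [Matrix.mul_assoc _ E, g2]
      calc mpInv S * S * mpInv C * (C * Y * N * mpInv N)
          = mpInv S * (S * (mpInv C * C)) * Y * N * mpInv N := by simp only [Matrix.mul_assoc]
        _ = _ := by rw [g1]
    have f3 : L M * (mpInv S * S) = mpInv S * S := by rw [← Matrix.mul_assoc, eS]
    have f4 : L M * L S = L M - mpInv S * S := by
      rw [L.eq_1 S, Matrix.mul_sub, f3, Matrix.mul_one]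
    -- The operators M†M, S†S and L_M L_S = L_M - S†S sum to the identity and split Y into three
    -- pieces. The first is completed by R_D, the second by R_N.
    refine ⟨mpInv S * S * Y, Y, mpInv M * M * Y, ?_⟩
    rw [f1, f2, f4, ← Matrix.mul_assoc, f3]
    simp only [L, R, Matrix.mul_sub, Matrix.sub_mul, Matrix.mul_assoc, Matrix.mul_one,
      Matrix.one_mul]
    abel
  · rintro ⟨Z₁, Z₄, Z₅, rfl⟩
    have hC := mul_general_mul (N := N) hM hS h Z₁ Z₄ Z₅
    obtain ⟨c1, c2, c3, c4⟩ := h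
    -- This removes every S-term of C Y D from the first equation; in the second, the Z₁-term dies
    -- because R_N N = 0.
    have RS : R A * S = 0 := by rw [hS, ← Matrix.mul_assoc, ← hM, mul_L_self]
    constructor
    · rw [Matrix.mul_assoc (R A), Matrix.mul_assoc (R A), hC]
      have : R A * (C * mpInv M * E) = R A * E := by
        rw [Matrix.mul_assoc C, ← Matrix.mul_assoc (R A), ← hM, ← eM, Matrix.mul_assoc _ (R A) E]
        rw [Matrix.mul_assoc, ← hM] at c1
        exact mul_mpInv_mul_of_R_mul c1
      rw [Matrix.mul_add, Matrix.mul_add, this]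
      simp only [← Matrix.mul_assoc, RS, Matrix.zero_mul, add_zero]
    · rw [← Matrix.mul_assoc, hC, Matrix.add_mul, Matrix.add_mul, Matrix.mul_assoc _ D (L B),
        Matrix.mul_assoc _ D (L B), ← hN, Matrix.mul_assoc _ (R N) N, R_mul_self,
        Matrix.mul_zero, add_zero]
      have g1 : E * mpInv N * N = E * L B := by
        rw [← eN, ← Matrix.mul_assoc, Matrix.mul_assoc (E * L B)]
        exact mul_mpInv_mul_of_mul_L (hN ▸ c2)
      have g2 : C * (mpInv C * (E * L B)) = E * L B :=
        mul_mpInv_mul_of_R_mul (by rw [← Matrix.mul_assoc, c4])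
      have g3 : S * mpInv C * E * mpInv N * N = S * (mpInv C * (E * L B)) := by
        rw [← g1]; simp only [Matrix.mul_assoc]
      have g4 : mpInv M * (M * (mpInv C * (E * L B))) = mpInv M * (E * L B) := by
        have : M * (mpInv C * (E * L B)) = R A * (E * L B) := by
          conv_lhs => rw [hM, Matrix.mul_assoc, g2]
        rw [this, ← Matrix.mul_assoc, eM]
      rw [g3, hS, L.eq_1 M]
      simp only [Matrix.mul_sub, Matrix.sub_mul, Matrix.mul_assoc, Matrix.mul_one, g2, g4]
      abel

/-- The general solution of `A X B + C Y D = E`. -/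
theorem mul_mul_add_mul_mul_eq_iff (hM : M = R A * C) (hN : N = D * L B) (hS : S = C * L M)
    (X : Matrix n k ℍ[ℝ]) (Y : Matrix p r ℍ[ℝ]) :
    A * X * B + C * Y * D = E ↔ TwoTermConditions A B C D E ∧ ∃ (Z₁ : Matrix p r ℍ[ℝ])
      (Z₂ Z₃ : Matrix n k ℍ[ℝ]) (Z₄ Z₅ : Matrix p r ℍ[ℝ]),
      X = mpInv A * E * mpInv B - mpInv A * C * mpInv M * E * mpInv B
        - mpInv A * S * mpInv C * E * mpInv N * D * mpInv B
        - mpInv A * S * Z₁ * R N * D * mpInv B + L A * Z₂ + Z₃ * R B ∧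
      Y = mpInv M * E * mpInv D + mpInv S * S * mpInv C * E * mpInv N + L M * L S * Z₄
        + L M * Z₁ * R N + Z₅ * R D := by
  rw [mul_mul_add_mul_mul_eq_iff_aux]
  have key : ∀ (h : TwoTermConditions A B C D E) (Z₁ Z₄ Z₅ : Matrix p r ℍ[ℝ]),
      mpInv A * (E - C * (mpInv M * E * mpInv D + mpInv S * S * mpInv C * E * mpInv N
        + L M * L S * Z₄ + L M * Z₁ * R N + Z₅ * R D) * D) * mpInv B
      = mpInv A * E * mpInv B - mpInv A * C * mpInv M * E * mpInv B
        - mpInv A * S * mpInv C * E * mpInv N * D * mpInv B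
        - mpInv A * S * Z₁ * R N * D * mpInv B := by
    intro h Z₁ Z₄ Z₅
    rw [mul_general_mul hM hS h]
    simp only [Matrix.mul_sub, Matrix.sub_mul, Matrix.mul_add, Matrix.add_mul, Matrix.mul_assoc]
    abel
  constructor
  · rintro ⟨hY, U, V, rfl⟩
    have h := TwoTermConditions.of_eq hY.1 hY.2
    obtain ⟨Z₁, Z₄, Z₅, rfl⟩ := (pair_iff hM hN hS h Y).1 hY
    exact ⟨h, Z₁, U, V, Z₄, Z₅, by rw [key h], rfl⟩
  · rintro ⟨h, Z₁, Z₂, Z₃, Z₄, Z₅, rfl, rfl⟩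
    exact ⟨(pair_iff hM hN hS h _).2 ⟨Z₁, Z₄, Z₅, rfl⟩, Z₂, Z₃, by rw [key h]⟩

end TwoTerm

end MoorePenroseLemmas

/-! ### Rank of the block matrix (C A; B 0) -/

section Rank

variable {m n k l : Type*}

theorem qrank_fromCols_comm (A : Matrix m n ℍ[ℝ]) (B : Matrix m l ℍ[ℝ]) :
    qrank (fromCols A B) = qrank (fromCols B A) := by
  have h : Set.range (fromCols A B).col = Set.range (fromCols B A).col := by
    rw [← (Equiv.sumComm n l).surjective.range_comp (fromCols B A).col]
    congr 1
    ext1 (i | i) <;> rfl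
  rw [qrank, qrank, h]

variable [Fintype n] [Fintype l]

/-- Multiplication by `A` from the left, as a map of right vector spaces. -/
def mulVecRight (A : Matrix m n ℍ[ℝ]) : (n → ℍ[ℝ]) →ₗ[(ℍ[ℝ])ᵐᵒᵖ] (m → ℍ[ℝ]) where
  toFun v := A *ᵥ v
  map_add' v w := Matrix.mulVec_add A v w
  map_smul' c v := Matrix.mulVec_smul A c v

theorem mulVecRight_apply (A : Matrix m n ℍ[ℝ]) (v : n → ℍ[ℝ]) : mulVecRight A v = A *ᵥ v := rfl

theorem span_range_col (A : Matrix m n ℍ[ℝ]) :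
    Submodule.span (ℍ[ℝ])ᵐᵒᵖ (Set.range A.col) = LinearMap.range (mulVecRight A) := by
  classical
  apply le_antisymm
  · rw [Submodule.span_le]
    rintro _ ⟨j, rfl⟩
    exact ⟨Pi.single j 1, by rw [mulVecRight_apply, Matrix.mulVec_single_one]⟩
  · rintro _ ⟨v, rfl⟩
    have : mulVecRight A v = ∑ j, MulOpposite.op (v j) • A.col j := by
      rw [mulVecRight_apply, Matrix.mulVec_eq_sum]
      rfl
    rw [this]
    exact Submodule.sum_mem _ fun j _ =>
      Submodule.smul_mem _ _ (Submodule.subset_span ⟨j, rfl⟩)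

theorem qrank_eq (A : Matrix m n ℍ[ℝ]) :
    qrank A = Module.finrank (ℍ[ℝ])ᵐᵒᵖ (LinearMap.range (mulVecRight A)) := by
  rw [qrank, span_range_col]

instance : Module.Finite (ℍ[ℝ])ᵐᵒᵖ ℍ[ℝ] :=
  ⟨⟨{1}, by
    rw [eq_top_iff]
    rintro x -
    have : x = MulOpposite.op x • (1 : ℍ[ℝ]) := by simp
    rw [this]
    exact Submodule.smul_mem _ _ (Submodule.subset_span (by simp))⟩⟩

variable (A : Matrix m n ℍ[ℝ]) (B : Matrix k l ℍ[ℝ]) (C : Matrix m l ℍ[ℝ])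

/-- The column space of `(C A; B 0)` projects onto that of `B`; the kernel of the projection is
the sum of the column space of `A` and of the image under `C` of the null space of `B`. -/
theorem qrank_fromBlocks : qrank (fromBlocks C A B 0) = qrank B +
    Module.finrank (ℍ[ℝ])ᵐᵒᵖ ↥(LinearMap.range (mulVecRight A) ⊔
      (LinearMap.ker (mulVecRight B)).map (mulVecRight C)) := by
  set T := mulVecRight (fromBlocks C A B 0)
  let π : (m ⊕ k → ℍ[ℝ]) →ₗ[(ℍ[ℝ])ᵐᵒᵖ] (k → ℍ[ℝ]) := LinearMap.funLeft _ _ Sum.inr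
  let ρ : (m ⊕ k → ℍ[ℝ]) →ₗ[(ℍ[ℝ])ᵐᵒᵖ] (m → ℍ[ℝ]) := LinearMap.funLeft _ _ Sum.inl
  have hπ : ∀ v, π (T v) = mulVecRight B (v ∘ Sum.inl) := fun v => by
    ext i : 1
    exact congrFun (fromBlocks_mulVec C A B 0 v) (Sum.inr i) |>.trans (by simp [mulVecRight_apply])
  have hρ : ∀ v, ρ (T v) = mulVecRight C (v ∘ Sum.inl) + mulVecRight A (v ∘ Sum.inr) :=
    fun v => by
      ext i : 1
      exact congrFun (fromBlocks_mulVec C A B 0 v) (Sum.inl i)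
  let f := π.domRestrict (LinearMap.range T)
  have hf : LinearMap.range f = LinearMap.range (mulVecRight B) := by
    ext w
    constructor
    · rintro ⟨⟨_, v, rfl⟩, rfl⟩
      exact ⟨v ∘ Sum.inl, (hπ v).symm⟩
    · rintro ⟨v, rfl⟩
      refine ⟨⟨T (Sum.elim v 0), _, rfl⟩, ?_⟩
      exact hπ _
  let g := (ρ.domRestrict (LinearMap.range T)).domRestrict (LinearMap.ker f)
  have hg : LinearMap.range g = LinearMap.range (mulVecRight A) ⊔
      (LinearMap.ker (mulVecRight B)).map (mulVecRight C) := by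
    ext w
    rw [Submodule.mem_sup]
    constructor
    · rintro ⟨⟨⟨_, v, rfl⟩, hv⟩, rfl⟩
      refine ⟨_, ⟨v ∘ Sum.inr, rfl⟩, _, ⟨v ∘ Sum.inl, ?_, rfl⟩, ?_⟩
      · exact (hπ v).symm.trans hv
      · exact (add_comm _ _).trans (hρ v).symm
    · rintro ⟨_, ⟨y, rfl⟩, _, ⟨x, hx, rfl⟩, rfl⟩
      refine ⟨⟨⟨T (Sum.elim x y), _, rfl⟩, ?_⟩, ?_⟩
      · exact (hπ _).trans hx
      · exact (hρ _).trans (add_comm _ _)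
  -- On the kernel of f the lower component vanishes, so the upper one determines the vector.
  have hg0 : Function.Injective g := by
    rw [injective_iff_map_eq_zero]
    rintro ⟨⟨w, hw⟩, hw1⟩ hw2
    apply Subtype.ext
    apply Subtype.ext
    ext1 (i | i)
    · exact congrFun hw2 i
    · exact congrFun hw1 i
  rw [qrank_eq, qrank_eq, ← hf, ← hg,
    LinearMap.finrank_range_of_inj hg0]
  exact (LinearMap.finrank_range_add_finrank_ker f).symm

/-- By `qrank_fromBlocks`, equality means that adding C(ker B) to the column space of A does not
raise the dimension, that is, C(ker B) lies in it. R_A annihilates exactly that column space and L_B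
projects onto ker B. -/
theorem qrank_fromBlocks_eq_iff [Fintype m] [Fintype k] [DecidableEq m] [DecidableEq l] :
    qrank (fromBlocks C A B 0) = qrank A + qrank B ↔ R A * C * L B = 0 := by
  rw [qrank_fromBlocks, add_comm, Nat.add_right_cancel_iff, qrank_eq]
  have h1 : (R A * C * L B = 0) ↔ (LinearMap.ker (mulVecRight B)).map (mulVecRight C) ≤
      LinearMap.range (mulVecRight A) := by
    constructor
    · rintro h _ ⟨x, hx, rfl⟩
      have hx' : B *ᵥ x = 0 := hx
      have hL : L B *ᵥ x = x := by
        rw [L, Matrix.sub_mulVec, ← Matrix.mulVec_mulVec, hx', Matrix.mulVec_zero,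
          Matrix.one_mulVec, sub_zero]
      have h2 : C *ᵥ x = A *ᵥ (mpInv A *ᵥ (C *ᵥ x)) := by
        have h3 : (R A * C * L B) *ᵥ x = 0 := by rw [h, Matrix.zero_mulVec]
        rw [← Matrix.mulVec_mulVec, hL, ← Matrix.mulVec_mulVec, R, Matrix.sub_mulVec,
          Matrix.one_mulVec, sub_eq_zero, ← Matrix.mulVec_mulVec] at h3
        exact h3
      exact ⟨_, h2.symm⟩
    · intro h
      apply Matrix.ext_of_mulVec_single
      intro j
      have hx : L B *ᵥ Pi.single j 1 ∈ LinearMap.ker (mulVecRight B) := by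
        rw [LinearMap.mem_ker, mulVecRight_apply, Matrix.mulVec_mulVec, mul_L_self,
          Matrix.zero_mulVec]
      obtain ⟨y, hy⟩ := h ⟨_, hx, rfl⟩
      rw [mulVecRight_apply, mulVecRight_apply] at hy
      rw [← Matrix.mulVec_mulVec, ← Matrix.mulVec_mulVec, ← hy, Matrix.mulVec_mulVec, R_mul_self,
        Matrix.zero_mulVec, Matrix.zero_mulVec]
  rw [h1]
  constructor
  · intro h
    rw [Submodule.eq_of_le_of_finrank_eq le_sup_left h.symm]
    exact le_sup_right
  · intro h
    rw [sup_eq_left.2 h]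

end Rank

/-! ### Elimination in the system -/

namespace Data

variable {a₁ a₂ a₃ a₄ a₅ b₁ b₂ b₃ b₄ b₅ : ℕ} (d : Data a₁ a₂ a₃ a₄ a₅ b₁ b₂ b₃ b₄ b₅)

/-- The right-hand side of the second equation after elimination of the first one. -/
noncomputable def K (V : Matrix (Fin a₂) (Fin b₂) ℍ[ℝ]) : Matrix (Fin a₃) (Fin b₂) ℍ[ℝ] :=
  d.C₂ + d.A₂ * R d.A₁ * d.C₁ * mpInv d.B₁ - d.A₂ * V * R d.B₁

/-- The right-hand side of the fourth equation after elimination of the third one. -/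
noncomputable def Q (U : Matrix (Fin a₃) (Fin b₄) ℍ[ℝ]) : Matrix (Fin a₄) (Fin b₅) ℍ[ℝ] :=
  d.C₄ - R d.A₃ * d.C₃ * mpInv d.B₃ * d.B₄ + d.A₃ * U * d.B₄

/-- Explains A₁₁, B₁₁, C₁₁: once the first equation is solved, solvability of the second is a linear
equation in the free parameter V₁. A₂₂, B₂₂, C₂₂, D₂₂ arise likewise from the other half. -/
theorem R_mul_K_mul_L_eq_zero_iff (V : Matrix (Fin a₂) (Fin b₂) ℍ[ℝ]) :
    R (d.A₂ * d.A₁) * d.K V * L d.B₂ = 0 ↔ d.A₁₁ * V * d.B₁₁ = d.C₁₁ := by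
  have : R (d.A₂ * d.A₁) * d.K V * L d.B₂ = d.C₁₁ - d.A₁₁ * V * d.B₁₁ := by
    simp only [K, C₁₁, A₁₁, B₁₁, Matrix.mul_add, Matrix.add_mul, Matrix.mul_sub, Matrix.sub_mul,
      Matrix.mul_assoc]
    abel
  rw [this, sub_eq_zero, eq_comm]

theorem R_mul_Q_mul_L_eq_zero_iff (U : Matrix (Fin a₃) (Fin b₄) ℍ[ℝ]) :
    R d.A₄ * d.Q U * L d.A₂₂ = 0 ↔ d.B₂₂ * U * d.C₂₂ = d.D₂₂ := by
  have : R d.A₄ * d.Q U * L d.A₂₂ = d.B₂₂ * U * d.C₂₂ - d.D₂₂ := by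
    simp only [Q, B₂₂, C₂₂, D₂₂, Matrix.mul_add, Matrix.add_mul, Matrix.mul_sub, Matrix.sub_mul,
      Matrix.mul_assoc]
    abel
  rw [this, sub_eq_zero]

/-- The general solution of the first two equations. -/
theorem first_half_iff (X₁ : Matrix (Fin a₁) (Fin b₁) ℍ[ℝ]) (X₂ : Matrix (Fin a₂) (Fin b₂) ℍ[ℝ])
    (X₃ : Matrix (Fin a₃) (Fin b₃) ℍ[ℝ]) :
    (d.A₁ * X₁ - X₂ * d.B₁ = d.C₁ ∧ d.A₂ * X₂ - X₃ * d.B₂ = d.C₂) ↔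
      (R d.A₁ * d.C₁ * L d.B₁ = 0 ∧ R d.A₁₁ * d.C₁₁ = 0 ∧ d.C₁₁ * L d.B₁₁ = 0) ∧
      ∃ (W₂ W₃ V₁ : Matrix (Fin a₂) (Fin b₂) ℍ[ℝ]) (W₄ : Matrix (Fin a₁) (Fin b₃) ℍ[ℝ])
        (W₅ : Matrix (Fin a₃) (Fin b₃) ℍ[ℝ]) (W₆ U₁ : Matrix (Fin a₁) (Fin b₂) ℍ[ℝ])
        (W₁ : Matrix (Fin a₁) (Fin b₁) ℍ[ℝ]),
        V₁ = mpInv d.A₁₁ * d.C₁₁ * mpInv d.B₁₁ + L d.A₁₁ * W₂ + W₃ * R d.B₁₁ ∧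
        U₁ = mpInv (d.A₂ * d.A₁) * d.K V₁ + W₄ * d.B₂ + L (d.A₂ * d.A₁) * W₆ ∧
        X₁ = mpInv d.A₁ * d.C₁ + U₁ * d.B₁ + L d.A₁ * W₁ ∧
        X₂ = -(R d.A₁ * d.C₁ * mpInv d.B₁) + d.A₁ * U₁ + V₁ * R d.B₁ ∧
        X₃ = -(R (d.A₂ * d.A₁) * d.K V₁ * mpInv d.B₂) + d.A₂ * d.A₁ * W₄ + W₅ * R d.B₂ := by
  have e : ∀ (U : Matrix (Fin a₁) (Fin b₂) ℍ[ℝ]) (V : Matrix (Fin a₂) (Fin b₂) ℍ[ℝ]),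
      d.A₂ * (-(R d.A₁ * d.C₁ * mpInv d.B₁) + d.A₁ * U + V * R d.B₁) - X₃ * d.B₂ = d.C₂
      ↔ d.A₂ * d.A₁ * U - X₃ * d.B₂ = d.K V := fun U V => by
    rw [← sub_eq_zero, ← sub_eq_zero (b := d.K V)]
    refine Eq.congr ?_ rfl
    simp only [K, Matrix.mul_add, Matrix.mul_neg, Matrix.mul_assoc]
    abel
  constructor
  · rintro ⟨h1, h2⟩
    obtain ⟨c1, U₁, V₁, W₁, rfl, rfl⟩ := (mul_sub_mul_eq_iff _ _ _ _ _).1 h1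
    obtain ⟨c2, W₄, W₅, W₆, hU, rfl⟩ := (mul_sub_mul_eq_iff _ _ _ _ _).1 ((e _ _).1 h2)
    obtain ⟨⟨c3, c4⟩, W₂, W₃, hV⟩ :=
      (mul_mul_eq_iff _ _ _ _).1 ((d.R_mul_K_mul_L_eq_zero_iff _).1 c2)
    exact ⟨⟨c1, c3, c4⟩, W₂, W₃, V₁, W₄, W₅, W₆, U₁, W₁, hV, hU, rfl, rfl, rfl⟩
  · rintro ⟨⟨c1, c3, c4⟩, W₂, W₃, V₁, W₄, W₅, W₆, U₁, W₁, hV, hU, rfl, rfl, hX₃⟩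
    have c2 := (d.R_mul_K_mul_L_eq_zero_iff _).2
      ((mul_mul_eq_iff _ _ _ _).2 ⟨⟨c3, c4⟩, W₂, W₃, hV⟩)
    exact ⟨(mul_sub_mul_eq_iff _ _ _ _ _).2 ⟨c1, U₁, V₁, W₁, rfl, rfl⟩,
      (e _ _).2 ((mul_sub_mul_eq_iff _ _ _ _ _).2 ⟨c2, W₄, W₅, W₆, hU, hX₃⟩)⟩

/-- The general solution of the last two equations. -/
theorem second_half_iff (X₃ : Matrix (Fin a₃) (Fin b₃) ℍ[ℝ]) (X₄ : Matrix (Fin a₄) (Fin b₄) ℍ[ℝ])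
    (X₅ : Matrix (Fin a₅) (Fin b₅) ℍ[ℝ]) :
    (d.A₃ * X₃ - X₄ * d.B₃ = d.C₃ ∧ d.A₄ * X₅ - X₄ * d.B₄ = d.C₄) ↔
      (R d.A₃ * d.C₃ * L d.B₃ = 0 ∧ R d.B₂₂ * d.D₂₂ = 0 ∧ d.D₂₂ * L d.C₂₂ = 0) ∧
      ∃ (T₁ : Matrix (Fin a₃) (Fin b₃) ℍ[ℝ]) (T₂ T₃ U₂ : Matrix (Fin a₃) (Fin b₄) ℍ[ℝ])
        (T₄ : Matrix (Fin a₅) (Fin b₄) ℍ[ℝ]) (T₅ V₂ : Matrix (Fin a₄) (Fin b₄) ℍ[ℝ])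
        (T₆ : Matrix (Fin a₅) (Fin b₅) ℍ[ℝ]),
        U₂ = mpInv d.B₂₂ * d.D₂₂ * mpInv d.C₂₂ + L d.B₂₂ * T₂ + T₃ * R d.C₂₂ ∧
        V₂ = -(R d.A₄ * d.Q U₂ * mpInv d.A₂₂) + d.A₄ * T₄ + T₅ * R d.A₂₂ ∧
        X₃ = mpInv d.A₃ * d.C₃ + U₂ * d.B₃ + L d.A₃ * T₁ ∧
        X₄ = -(R d.A₃ * d.C₃ * mpInv d.B₃) + d.A₃ * U₂ + V₂ * R d.B₃ ∧
        X₅ = mpInv d.A₄ * d.Q U₂ + T₄ * d.A₂₂ + L d.A₄ * T₆ := by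
  have e : ∀ (U : Matrix (Fin a₃) (Fin b₄) ℍ[ℝ]) (V : Matrix (Fin a₄) (Fin b₄) ℍ[ℝ]),
      d.A₄ * X₅ - (-(R d.A₃ * d.C₃ * mpInv d.B₃) + d.A₃ * U + V * R d.B₃) * d.B₄ = d.C₄
      ↔ d.A₄ * X₅ - V * d.A₂₂ = d.Q U := fun U V => by
    rw [← sub_eq_zero, ← sub_eq_zero (b := d.Q U)]
    refine Eq.congr ?_ rfl
    simp only [Q, A₂₂, Matrix.add_mul, Matrix.neg_mul, Matrix.mul_assoc]
    abel
  constructor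
  · rintro ⟨h1, h2⟩
    obtain ⟨c1, U₂, V₂, T₁, rfl, rfl⟩ := (mul_sub_mul_eq_iff _ _ _ _ _).1 h1
    obtain ⟨c2, T₄, T₅, T₆, rfl, hV⟩ := (mul_sub_mul_eq_iff _ _ _ _ _).1 ((e _ _).1 h2)
    obtain ⟨⟨c3, c4⟩, T₂, T₃, hU⟩ :=
      (mul_mul_eq_iff _ _ _ _).1 ((d.R_mul_Q_mul_L_eq_zero_iff _).1 c2)
    exact ⟨⟨c1, c3, c4⟩, T₁, T₂, T₃, U₂, T₄, T₅, V₂, T₆, hU, hV, rfl, rfl, rfl⟩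
  · rintro ⟨⟨c1, c3, c4⟩, T₁, T₂, T₃, U₂, T₄, T₅, V₂, T₆, hU, hV, rfl, rfl, hX₅⟩
    have c2 := (d.R_mul_Q_mul_L_eq_zero_iff _).2
      ((mul_mul_eq_iff _ _ _ _).2 ⟨⟨c3, c4⟩, T₂, T₃, hU⟩)
    exact ⟨(mul_sub_mul_eq_iff _ _ _ _ _).2 ⟨c1, U₂, V₂, T₁, rfl, rfl⟩,
      (e _ _).2 ((mul_sub_mul_eq_iff _ _ _ _ _).2 ⟨c2, T₄, T₅, T₆, hX₅, hV⟩)⟩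

/-- The difference of the two expressions for the third unknown. -/
theorem third_sub_third (hC₁₁ : R d.A₁₁ * d.C₁₁ = 0)
    {W₂ W₃ V₁ : Matrix (Fin a₂) (Fin b₂) ℍ[ℝ]} {W₄ : Matrix (Fin a₁) (Fin b₃) ℍ[ℝ]}
    {W₅ T₁ : Matrix (Fin a₃) (Fin b₃) ℍ[ℝ]} {T₂ T₃ U₂ : Matrix (Fin a₃) (Fin b₄) ℍ[ℝ]}
    (hV : V₁ = mpInv d.A₁₁ * d.C₁₁ * mpInv d.B₁₁ + L d.A₁₁ * W₂ + W₃ * R d.B₁₁)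
    (hU : U₂ = mpInv d.B₂₂ * d.D₂₂ * mpInv d.C₂₂ + L d.B₂₂ * T₂ + T₃ * R d.C₂₂) :
    mpInv d.A₃ * d.C₃ + U₂ * d.B₃ + L d.A₃ * T₁
      - (-(R (d.A₂ * d.A₁) * d.K V₁ * mpInv d.B₂) + d.A₂ * d.A₁ * W₄ + W₅ * R d.B₂)
        = d.E₁ - d.A₁₁ * W₃ * d.A₄₄ - d.B₄₄ * T₂ * d.B₃
          - (d.A₃₃ * fromRows W₄ T₁ + fromCols W₅ T₃ * d.B₃₃) := by
  have hA : ∀ X : Matrix (Fin a₂) (Fin b₃) ℍ[ℝ],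
      R (d.A₂ * d.A₁) * (d.A₂ * X) = d.A₁₁ * X := fun X => by rw [A₁₁, Matrix.mul_assoc]
  have hK : R (d.A₂ * d.A₁) * d.K V₁ * mpInv d.B₂ = R (d.A₂ * d.A₁) * d.C₂ * mpInv d.B₂
      + d.A₁₁ * R d.A₁ * d.C₁ * mpInv d.B₁ * mpInv d.B₂
      - d.C₁₁ * mpInv d.B₁₁ * R d.B₁ * mpInv d.B₂ - d.A₁₁ * W₃ * d.A₄₄ := by
    -- V₁ enters only through A₁₁V₁: the condition on C₁₁ simplifies its particular part, and W₂
    -- drops out since A₁₁L_{A₁₁} = 0. Only W₃ survives.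
    have h := mul_mpInv_mul_of_R_mul hC₁₁
    have h' : ∀ X : Matrix (Fin b₂) (Fin b₃) ℍ[ℝ],
        d.A₁₁ * (mpInv d.A₁₁ * (d.C₁₁ * X)) = d.C₁₁ * X := fun X => by
      rw [← Matrix.mul_assoc (mpInv _), ← Matrix.mul_assoc, h]
    simp only [K, A₄₄, hV, Matrix.mul_add, Matrix.add_mul, Matrix.mul_sub, Matrix.sub_mul,
      Matrix.mul_assoc, hA, h', mul_L_self_assoc]
    abel
  rw [hK, hU, A₃₃, B₃₃, fromCols_mul_fromRows, fromCols_mul_fromRows]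
  simp only [E₁, B₄₄, Matrix.add_mul, Matrix.neg_mul, Matrix.mul_neg, Matrix.mul_assoc]
  abel

/-- The two expressions for the third unknown agree iff their parameters solve a two-sided
equation with coefficients `A₃₃`, `B₃₃`. -/
theorem third_eq_third_iff (hC₁₁ : R d.A₁₁ * d.C₁₁ = 0)
    {W₂ W₃ V₁ : Matrix (Fin a₂) (Fin b₂) ℍ[ℝ]} {W₄ : Matrix (Fin a₁) (Fin b₃) ℍ[ℝ]}
    {W₅ T₁ : Matrix (Fin a₃) (Fin b₃) ℍ[ℝ]} {T₂ T₃ U₂ : Matrix (Fin a₃) (Fin b₄) ℍ[ℝ]}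
    (hV : V₁ = mpInv d.A₁₁ * d.C₁₁ * mpInv d.B₁₁ + L d.A₁₁ * W₂ + W₃ * R d.B₁₁)
    (hU : U₂ = mpInv d.B₂₂ * d.D₂₂ * mpInv d.C₂₂ + L d.B₂₂ * T₂ + T₃ * R d.C₂₂) :
    -(R (d.A₂ * d.A₁) * d.K V₁ * mpInv d.B₂) + d.A₂ * d.A₁ * W₄ + W₅ * R d.B₂
        = mpInv d.A₃ * d.C₃ + U₂ * d.B₃ + L d.A₃ * T₁ ↔
      d.A₃₃ * fromRows W₄ T₁ + fromCols W₅ T₃ * d.B₃₃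
        = d.E₁ - d.A₁₁ * W₃ * d.A₄₄ - d.B₄₄ * T₂ * d.B₃ := by
  rw [eq_comm, ← sub_eq_zero, d.third_sub_third hC₁₁ hV hU, sub_eq_zero, eq_comm]

/-- Solvability of the block equation in (W₄; T₁) and (W₅, T₃) restricts the parameters W₃ and T₂
that are still free. -/
theorem R_mul_sub_mul_L_eq_zero_iff (W₃ : Matrix (Fin a₂) (Fin b₂) ℍ[ℝ])
    (T₂ : Matrix (Fin a₃) (Fin b₄) ℍ[ℝ]) :
    R d.A₃₃ * (d.E₁ - d.A₁₁ * W₃ * d.A₄₄ - d.B₄₄ * T₂ * d.B₃) * L d.B₃₃ = 0 ↔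
      d.A * W₃ * d.B + d.C * T₂ * d.D = d.E := by
  have : R d.A₃₃ * (d.E₁ - d.A₁₁ * W₃ * d.A₄₄ - d.B₄₄ * T₂ * d.B₃) * L d.B₃₃
      = d.E - (d.A * W₃ * d.B + d.C * T₂ * d.D) := by
    simp only [A, B, C, D, E, Matrix.mul_sub, Matrix.sub_mul, Matrix.mul_assoc]
    abel
  rw [this, sub_eq_zero, eq_comm]

theorem twoTerm_iff (W₃ : Matrix (Fin a₂) (Fin b₂) ℍ[ℝ]) (T₂ : Matrix (Fin a₃) (Fin b₄) ℍ[ℝ]) :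
    d.A * W₃ * d.B + d.C * T₂ * d.D = d.E ↔ TwoTermConditions d.A d.B d.C d.D d.E ∧
      ∃ (Z₁ : Matrix (Fin a₃) (Fin b₄) ℍ[ℝ]) (Z₂ Z₃ : Matrix (Fin a₂) (Fin b₂) ℍ[ℝ])
        (Z₄ Z₅ : Matrix (Fin a₃) (Fin b₄) ℍ[ℝ]),
        W₃ = mpInv d.A * d.E * mpInv d.B - mpInv d.A * d.C * mpInv d.M * d.E * mpInv d.B
          - mpInv d.A * d.S * mpInv d.C * d.E * mpInv d.N * d.D * mpInv d.B
          - mpInv d.A * d.S * Z₁ * R d.N * d.D * mpInv d.B + L d.A * Z₂ + Z₃ * R d.B ∧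
        T₂ = mpInv d.M * d.E * mpInv d.D + mpInv d.S * d.S * mpInv d.C * d.E * mpInv d.N
          + L d.M * L d.S * Z₄ + L d.M * Z₁ * R d.N + Z₅ * R d.D :=
  mul_mul_add_mul_mul_eq_iff (M := d.M) (N := d.N) (S := d.S) rfl rfl rfl W₃ T₂

theorem projectorConditions_iff : d.ProjectorConditions ↔
    (R d.A₁ * d.C₁ * L d.B₁ = 0 ∧ R d.A₁₁ * d.C₁₁ = 0 ∧ d.C₁₁ * L d.B₁₁ = 0) ∧
    (R d.A₃ * d.C₃ * L d.B₃ = 0 ∧ R d.B₂₂ * d.D₂₂ = 0 ∧ d.D₂₂ * L d.C₂₂ = 0) ∧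
    TwoTermConditions d.A d.B d.C d.D d.E := by
  simp only [ProjectorConditions, TwoTermConditions, and_assoc, M, N]

/-! ### Projector conditions and the general solution -/

variable {d}

theorem ProjectorConditions.blocks_eq (h : d.ProjectorConditions)
    (p : Params a₁ a₂ a₃ a₄ a₅ b₁ b₂ b₃ b₄ b₅) :
    d.A₃₃ * fromRows (d.W₄ p) (d.T₁ p) + fromCols (d.W₅ p) (d.T₃ p) * d.B₃₃
      = d.E₁ - d.A₁₁ * d.W₃ p * d.A₄₄ - d.B₄₄ * d.T₂ p * d.B₃ := by
  have h2 := (d.twoTerm_iff (d.W₃ p) (d.T₂ p)).2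
    ⟨(d.projectorConditions_iff.1 h).2.2, p.Z₁, p.Z₂, p.Z₃, p.Z₄, p.Z₅, rfl, rfl⟩
  rw [W₄, T₁, W₅, T₃, fromRows_toRows, fromCols_toCols]
  exact (mul_add_mul_eq_iff _ _ _ _ _).2
    ⟨(d.R_mul_sub_mul_L_eq_zero_iff _ _).2 h2, p.Z₆, p.Z₇, p.Z₈, rfl, rfl⟩

theorem ProjectorConditions.third_eq_third (h : d.ProjectorConditions)
    (p : Params a₁ a₂ a₃ a₄ a₅ b₁ b₂ b₃ b₄ b₅) : d.X₃ p = d.X₃' p :=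
  (d.third_eq_third_iff h.2.1 (V₁ := d.V₁ p) (U₂ := d.U₂ p) rfl rfl).2 (h.blocks_eq p)

theorem ProjectorConditions.isSolution (h : d.ProjectorConditions)
    (p : Params a₁ a₂ a₃ a₄ a₅ b₁ b₂ b₃ b₄ b₅) :
    d.IsSolution (d.X₁ p) (d.X₂ p) (d.X₃ p) (d.X₄ p) (d.X₅ p) := by
  obtain ⟨h1, h2, -⟩ := d.projectorConditions_iff.1 h
  obtain ⟨e1, e2⟩ := (d.first_half_iff (d.X₁ p) (d.X₂ p) (d.X₃ p)).2
    ⟨h1, p.W₂, d.W₃ p, d.V₁ p, d.W₄ p, d.W₅ p, p.W₆, d.U₁ p, p.W₁, rfl, rfl, rfl, rfl, rfl⟩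
  obtain ⟨e3, e4⟩ := (d.second_half_iff (d.X₃ p) (d.X₄ p) (d.X₅ p)).2
    ⟨h2, d.T₁ p, d.T₂ p, d.T₃ p, d.U₂ p, p.T₄, p.T₅, d.V₂ p, p.T₆, rfl, rfl,
      h.third_eq_third p, rfl, rfl⟩
  exact ⟨e1, e2, e3, e4⟩

variable {X₁ : Matrix (Fin a₁) (Fin b₁) ℍ[ℝ]} {X₂ : Matrix (Fin a₂) (Fin b₂) ℍ[ℝ]}
  {X₃ : Matrix (Fin a₃) (Fin b₃) ℍ[ℝ]} {X₄ : Matrix (Fin a₄) (Fin b₄) ℍ[ℝ]}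
  {X₅ : Matrix (Fin a₅) (Fin b₅) ℍ[ℝ]}

/-- Each elimination step, read from left to right, yields both its solvability condition and the
parameters of the given solution. -/
theorem IsSolution.exists_params (h : d.IsSolution X₁ X₂ X₃ X₄ X₅) :
    d.ProjectorConditions ∧ ∃ p : Params a₁ a₂ a₃ a₄ a₅ b₁ b₂ b₃ b₄ b₅,
      X₁ = d.X₁ p ∧ X₂ = d.X₂ p ∧ X₃ = d.X₃ p ∧ X₄ = d.X₄ p ∧ X₅ = d.X₅ p := by
  obtain ⟨e1, e2, e3, e4⟩ := h
  obtain ⟨h1, W₂, W₃, V₁, W₄, W₅, W₆, U₁, W₁, hV₁, hU₁, hX₁, hX₂, hX₃⟩ :=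
    (d.first_half_iff _ _ _).1 ⟨e1, e2⟩
  obtain ⟨h2, T₁, T₂, T₃, U₂, T₄, T₅, V₂, T₆, hU₂, hV₂, hX₃', hX₄, hX₅⟩ :=
    (d.second_half_iff _ _ _).1 ⟨e3, e4⟩
  have hE := (d.third_eq_third_iff h1.2.1 hV₁ hU₂).1 (hX₃.symm.trans hX₃')
  obtain ⟨c, Z₆, Z₇, Z₈, hcol, hrow⟩ := (mul_add_mul_eq_iff _ _ _ _ _).1 hE
  obtain ⟨h3, Z₁, Z₂, Z₃, Z₄, Z₅, hW₃, hT₂⟩ :=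
    (d.twoTerm_iff _ _).1 ((d.R_mul_sub_mul_L_eq_zero_iff _ _).1 c)
  let p : Params a₁ a₂ a₃ a₄ a₅ b₁ b₂ b₃ b₄ b₅ :=
    ⟨W₁, W₂, W₆, T₄, T₅, T₆, Z₁, Z₂, Z₃, Z₄, Z₅, Z₆, Z₇, Z₈⟩
  obtain rfl : W₃ = d.W₃ p := hW₃
  obtain rfl : T₂ = d.T₂ p := hT₂
  have hcol' : fromRows W₄ T₁ = d.colBlock p := hcol
  have hrow' : fromCols W₅ T₃ = d.rowBlock p := hrow
  obtain rfl : W₄ = d.W₄ p := by rw [Data.W₄, ← hcol', toRows₁_fromRows]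
  obtain rfl : T₁ = d.T₁ p := by rw [Data.T₁, ← hcol', toRows₂_fromRows]
  obtain rfl : W₅ = d.W₅ p := by rw [Data.W₅, ← hrow', toCols₁_fromCols]
  obtain rfl : T₃ = d.T₃ p := by rw [Data.T₃, ← hrow', toCols₂_fromCols]
  obtain rfl : V₁ = d.V₁ p := hV₁
  obtain rfl : U₁ = d.U₁ p := hU₁
  obtain rfl : U₂ = d.U₂ p := hU₂
  obtain rfl : V₂ = d.V₂ p := hV₂
  exact ⟨d.projectorConditions_iff.2 ⟨h1, h2, h3⟩, p, hX₁, hX₂, hX₃, hX₄, hX₅⟩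

theorem consistent_iff_projectorConditions : d.Consistent ↔ d.ProjectorConditions := by
  constructor
  · rintro ⟨X₁, X₂, X₃, X₄, X₅, h⟩
    exact h.exists_params.1
  · intro h
    exact ⟨_, _, _, _, _, h.isSolution ⟨0, 0, 0, 0, 0, 0, 0, 0, 0, 0, 0, 0, 0, 0⟩⟩

end Data

/-! ### Rank conditions: necessity -/

namespace Data

variable {a₁ a₂ a₃ a₄ a₅ b₁ b₂ b₃ b₄ b₅ : ℕ} {d : Data a₁ a₂ a₃ a₄ a₅ b₁ b₂ b₃ b₄ b₅}

/-- The rank equalities in terms of projectors. -/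
theorem rankConditions_iff : d.RankConditions ↔
    R d.A₁ * d.C₁ * L d.B₁ = 0 ∧ R d.A₂ * d.C₂ * L d.B₂ = 0 ∧
    R d.A₃ * d.C₃ * L d.B₃ = 0 ∧ R d.A₄ * d.C₄ * L d.B₄ = 0 ∧
    R (d.A₂ * d.A₁) * (d.A₂ * d.C₁ + d.C₂ * d.B₁) * L (d.B₂ * d.B₁) = 0 ∧
    R (fromCols d.A₃ d.A₄) * fromCols d.C₃ d.C₄ * L (fromCols d.B₃ d.B₄) = 0 ∧
    R (fromCols (d.A₃ * d.A₂) d.A₄) * fromCols (d.A₃ * d.C₂ + d.C₃ * d.B₂) d.C₄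
      * L (fromCols (d.B₃ * d.B₂) d.B₄) = 0 ∧
    R (d.A₃ * d.A₂ * d.A₁) * (d.A₃ * d.A₂ * d.C₁ + d.A₃ * d.C₂ * d.B₁ + d.C₃ * d.B₂ * d.B₁)
      * L (d.B₃ * d.B₂ * d.B₁) = 0 ∧
    R (d.A₃ * d.A₂) * (d.A₃ * d.C₂ + d.C₃ * d.B₂) * L (d.B₃ * d.B₂) = 0 ∧
    R (fromCols d.A₄ (d.A₃ * d.A₂ * d.A₁))
      * fromCols (d.A₃ * d.A₂ * d.C₁ + d.A₃ * d.C₂ * d.B₁ + d.C₃ * d.B₂ * d.B₁) d.C₄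
      * L (fromCols (d.B₃ * d.B₂ * d.B₁) d.B₄) = 0 := by
  -- Only the last rank equality orders the column blocks differently on its two sides.
  rw [RankConditions, qrank_fromCols_comm (d.A₃ * d.A₂ * d.A₁) d.A₄]
  simp only [qrank_fromBlocks_eq_iff]

theorem Consistent.rankConditions (h : d.Consistent) : d.RankConditions := by
  obtain ⟨X₁, X₂, X₃, X₄, X₅, h1, h2, h3, h4⟩ := h
  -- Multiplying consecutive equations by A₂ on the left and B₁ on the right cancels the shared
  -- unknown X₂; the next two identities telescope in the same way.
  have h12 : d.A₂ * d.A₁ * X₁ - X₃ * (d.B₂ * d.B₁) = d.A₂ * d.C₁ + d.C₂ * d.B₁ := by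
    rw [← h1, ← h2]
    simp only [Matrix.mul_sub, Matrix.sub_mul, Matrix.mul_assoc]
    abel
  have h23 : d.A₃ * d.A₂ * X₂ - X₄ * (d.B₃ * d.B₂) = d.A₃ * d.C₂ + d.C₃ * d.B₂ := by
    rw [← h2, ← h3]
    simp only [Matrix.mul_sub, Matrix.sub_mul, Matrix.mul_assoc]
    abel
  have h123 : d.A₃ * d.A₂ * d.A₁ * X₁ - X₄ * (d.B₃ * d.B₂ * d.B₁)
      = d.A₃ * d.A₂ * d.C₁ + d.A₃ * d.C₂ * d.B₁ + d.C₃ * d.B₂ * d.B₁ := by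
    rw [← h1, ← h2, ← h3]
    simp only [Matrix.mul_sub, Matrix.sub_mul, Matrix.mul_assoc]
    abel
  -- Two equations sharing Y form one equation with a block-diagonal unknown. In `cols'` it is
  -- antidiagonal, as the last rank condition puts A₄ first.
  have cols : ∀ {m n k n' k' l : ℕ} {A : Matrix (Fin m) (Fin n) ℍ[ℝ]}
      {A' : Matrix (Fin m) (Fin n') ℍ[ℝ]} {B : Matrix (Fin l) (Fin k) ℍ[ℝ]}
      {B' : Matrix (Fin l) (Fin k') ℍ[ℝ]} {C C'} {X : Matrix (Fin n) (Fin k) ℍ[ℝ]}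
      {X' : Matrix (Fin n') (Fin k') ℍ[ℝ]} {Y : Matrix (Fin m) (Fin l) ℍ[ℝ]},
      A * X - Y * B = C → A' * X' - Y * B' = C' →
      fromCols A A' * fromBlocks X 0 0 X' - Y * fromCols B B' = fromCols C C' := by
    rintro m n k n' k' l A A' B B' _ _ X X' Y rfl rfl
    rw [fromCols_mul_fromBlocks, mul_fromCols]
    simp only [Matrix.mul_zero, add_zero, zero_add]
    ext i (j | j) : 2 <;> rfl
  have cols' : ∀ {m n k n' k' l : ℕ} {A : Matrix (Fin m) (Fin n) ℍ[ℝ]}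
      {A' : Matrix (Fin m) (Fin n') ℍ[ℝ]} {B : Matrix (Fin l) (Fin k) ℍ[ℝ]}
      {B' : Matrix (Fin l) (Fin k') ℍ[ℝ]} {C C'} {X : Matrix (Fin n) (Fin k) ℍ[ℝ]}
      {X' : Matrix (Fin n') (Fin k') ℍ[ℝ]} {Y : Matrix (Fin m) (Fin l) ℍ[ℝ]},
      A * X - Y * B = C → A' * X' - Y * B' = C' →
      fromCols A' A * fromBlocks 0 X' X 0 - Y * fromCols B B' = fromCols C C' := by
    rintro m n k n' k' l A A' B B' _ _ X X' Y rfl rfl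
    rw [fromCols_mul_fromBlocks, mul_fromCols]
    simp only [Matrix.mul_zero, add_zero, zero_add]
    ext i (j | j) : 2 <;> rfl
  exact rankConditions_iff.2 ⟨((mul_sub_mul_eq_iff _ _ _ _ _).1 h1).1,
    ((mul_sub_mul_eq_iff _ _ _ _ _).1 h2).1, ((mul_sub_mul_eq_iff _ _ _ _ _).1 h3).1,
    ((mul_sub_mul_eq_iff _ _ _ _ _).1 h4).1, ((mul_sub_mul_eq_iff _ _ _ _ _).1 h12).1,
    ((mul_sub_mul_eq_iff _ _ _ _ _).1 (cols h3 h4)).1,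
    ((mul_sub_mul_eq_iff _ _ _ _ _).1 (cols h23 h4)).1,
    ((mul_sub_mul_eq_iff _ _ _ _ _).1 h123).1, ((mul_sub_mul_eq_iff _ _ _ _ _).1 h23).1,
    ((mul_sub_mul_eq_iff _ _ _ _ _).1 (cols' h123 h4)).1⟩

/-! ### Factoring annihilators through the coefficients -/

section Annihilators

variable {q r : Type*}

/-- The preimage B₂†K may be changed by elements of ker B₂. A change that brings it into the column
space of B₁ exists because A₄₄K = R_{B₁₁}R_{B₁}B₂†K = 0. -/
theorem exists_eq_B₂_mul_B₁_mul {K : Matrix (Fin b₃) r ℍ[ℝ]} (h1 : R d.B₂ * K = 0)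
    (h2 : d.A₄₄ * K = 0) : ∃ Y : Matrix (Fin b₁) r ℍ[ℝ], K = d.B₂ * d.B₁ * Y := by
  set Y := mpInv d.B₂ * K with hY
  have hK : d.B₂ * Y = K := mul_mpInv_mul_of_R_mul h1
  set Y' := Y - L d.B₂ * (mpInv d.B₁₁ * (R d.B₁ * Y)) with hY'
  have e1 : R d.B₁ * Y' = 0 := by
    have h3 : R d.B₁₁ * (R d.B₁ * Y) = 0 := by
      rw [← h2, A₄₄, Matrix.mul_assoc, Matrix.mul_assoc]
    have h4 := mul_mpInv_mul_of_R_mul h3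
    rw [hY', Matrix.mul_sub, ← Matrix.mul_assoc _ (L d.B₂), sub_eq_zero]
    exact h4.symm
  refine ⟨mpInv d.B₁ * Y', ?_⟩
  rw [Matrix.mul_assoc, mul_mpInv_mul_of_R_mul e1, hY', Matrix.mul_sub, hK, mul_L_self_assoc,
    sub_zero]

theorem exists_B₃_mul_eq_B₄_mul {K : Matrix (Fin b₃) r ℍ[ℝ]} (h : R d.C₂₂ * d.B₃ * K = 0) :
    ∃ Y : Matrix (Fin b₅) r ℍ[ℝ], d.B₃ * K = d.B₄ * Y := by
  rw [Matrix.mul_assoc] at h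
  refine ⟨L d.A₂₂ * (mpInv d.C₂₂ * (d.B₃ * K)), ?_⟩
  rw [← Matrix.mul_assoc, ← C₂₂.eq_1, mul_mpInv_mul_of_R_mul h]

theorem exists_eq_mul_A₃ {J : Matrix q (Fin a₃) ℍ[ℝ]} (h : J * L d.A₃ = 0) :
    ∃ G : Matrix q (Fin a₄) ℍ[ℝ], J = G * d.A₃ :=
  ⟨J * mpInv d.A₃, by rw [Matrix.mul_assoc, mul_mpInv_mul_of_mul_L h]⟩

/-- J factors through B₂₂ = R_{A₄}A₃, and the factor R_{A₄} makes G kill A₄. -/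
theorem exists_eq_mul_A₃_of_mul_B₄₄ {J : Matrix q (Fin a₃) ℍ[ℝ]} (h : J * d.B₄₄ = 0) :
    ∃ G : Matrix q (Fin a₄) ℍ[ℝ], J = G * d.A₃ ∧ G * d.A₄ = 0 := by
  rw [B₄₄, Matrix.mul_neg, neg_eq_zero] at h
  refine ⟨J * mpInv d.B₂₂ * R d.A₄, ?_, ?_⟩
  · rw [Matrix.mul_assoc _ (R d.A₄), ← B₂₂, Matrix.mul_assoc, mul_mpInv_mul_of_mul_L h]
  · rw [Matrix.mul_assoc, R_mul_self, Matrix.mul_zero]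

theorem mul_A₃₃_eq_zero {J : Matrix q (Fin a₃) ℍ[ℝ]} (h : J * d.A₃₃ = 0) :
    J * (d.A₂ * d.A₁) = 0 ∧ J * L d.A₃ = 0 := by
  rw [A₃₃, mul_fromCols, ← fromCols_zero, fromCols_inj.eq_iff] at h
  simpa using h

theorem B₃₃_mul_eq_zero {K : Matrix (Fin b₃) r ℍ[ℝ]} (h : d.B₃₃ * K = 0) :
    R d.B₂ * K = 0 ∧ R d.C₂₂ * d.B₃ * K = 0 := by
  rw [B₃₃, fromRows_mul, ← fromRows_zero, fromRows_inj.eq_iff] at h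
  simpa using h

theorem mul_A₂_eq_zero {J : Matrix q (Fin a₃) ℍ[ℝ]} (h1 : J * (d.A₂ * d.A₁) = 0)
    (h2 : J * d.A₁₁ = 0) : J * d.A₂ = 0 := by
  rwa [A₁₁, ← Matrix.mul_assoc, mul_R_of_mul_eq_zero h1] at h2

variable {X₁ : Matrix (Fin a₁) (Fin b₁) ℍ[ℝ]} {X₂ : Matrix (Fin a₂) (Fin b₂) ℍ[ℝ]}
  {X₃ : Matrix (Fin a₃) (Fin b₃) ℍ[ℝ]} {X₄ : Matrix (Fin a₄) (Fin b₄) ℍ[ℝ]}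
  {X₅ : Matrix (Fin a₅) (Fin b₅) ℍ[ℝ]} {J : Matrix q (Fin a₃) ℍ[ℝ]}

/-- This and the next three lemmas express J X₃ K through the given matrices, J and K killing the
other unknowns. -/
theorem mul_X₃_mul_of_A₂ (h2 : d.A₂ * X₂ - X₃ * d.B₂ = d.C₂) (hJ : J * d.A₂ = 0)
    (Y : Matrix (Fin b₂) r ℍ[ℝ]) : J * X₃ * (d.B₂ * Y) = -(J * d.C₂ * Y) := by
  rw [← h2, Matrix.mul_sub, ← Matrix.mul_assoc J, hJ]
  simp only [Matrix.zero_mul, zero_sub, Matrix.neg_mul, neg_neg, Matrix.mul_assoc]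

theorem mul_X₃_mul_of_A₂_mul_A₁ (h1 : d.A₁ * X₁ - X₂ * d.B₁ = d.C₁)
    (h2 : d.A₂ * X₂ - X₃ * d.B₂ = d.C₂) (hJ : J * (d.A₂ * d.A₁) = 0)
    (Y : Matrix (Fin b₁) r ℍ[ℝ]) :
    J * X₃ * (d.B₂ * d.B₁ * Y) = -(J * (d.A₂ * d.C₁ + d.C₂ * d.B₁) * Y) := by
  have : J * (d.A₂ * (d.A₁ * (X₁ * Y))) = 0 := by
    rw [← Matrix.mul_assoc d.A₂, ← Matrix.mul_assoc, hJ, Matrix.zero_mul]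
  rw [← h1, ← h2]
  simp only [Matrix.mul_sub, Matrix.sub_mul, Matrix.mul_add, Matrix.add_mul, Matrix.mul_assoc,
    this]
  abel

theorem mul_A₃_mul_X₃_mul (h3 : d.A₃ * X₃ - X₄ * d.B₃ = d.C₃) {G : Matrix q (Fin a₄) ℍ[ℝ]}
    {K : Matrix (Fin b₃) r ℍ[ℝ]} (hK : d.B₃ * K = 0) :
    G * d.A₃ * X₃ * K = G * d.C₃ * K := by
  rw [← h3]
  simp only [Matrix.mul_sub, Matrix.sub_mul, Matrix.mul_assoc, hK, Matrix.mul_zero, sub_zero]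

theorem mul_A₃_mul_X₃_mul_of_A₄ (h3 : d.A₃ * X₃ - X₄ * d.B₃ = d.C₃)
    (h4 : d.A₄ * X₅ - X₄ * d.B₄ = d.C₄) {G : Matrix q (Fin a₄) ℍ[ℝ]} (hG : G * d.A₄ = 0)
    {K : Matrix (Fin b₃) r ℍ[ℝ]} {Y : Matrix (Fin b₅) r ℍ[ℝ]} (hK : d.B₃ * K = d.B₄ * Y) :
    G * d.A₃ * X₃ * K = G * d.C₃ * K - G * d.C₄ * Y := by
  have : G * (d.A₄ * (X₅ * Y)) = 0 := by rw [← Matrix.mul_assoc, hG, Matrix.zero_mul]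
  rw [← h3, ← h4]
  simp only [Matrix.mul_sub, Matrix.sub_mul, Matrix.mul_assoc, hK, this]
  abel

end Annihilators

/-! ### Rank conditions: sufficiency -/

theorem RankConditions.first_half (h : d.RankConditions) :
    R d.A₁ * d.C₁ * L d.B₁ = 0 ∧ R d.A₁₁ * d.C₁₁ = 0 ∧ d.C₁₁ * L d.B₁₁ = 0 := by
  obtain ⟨c1, c2, -, -, c5, -⟩ := rankConditions_iff.1 h
  refine ⟨c1, ?_, ?_⟩
  · have hJ : R d.A₁₁ * R (d.A₂ * d.A₁) * d.A₂ = 0 := by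
      rw [Matrix.mul_assoc, ← A₁₁, R_mul_self]
    have e := mul_mul_eq_zero_of_annihilates c2 hJ (mul_L_self d.B₂)
    rw [C₁₁, ← Matrix.mul_assoc, ← Matrix.mul_assoc, Matrix.mul_add, Matrix.add_mul, e]
    simp only [← Matrix.mul_assoc, hJ, Matrix.zero_mul, add_zero]
  -- K is killed by both R_{B₁} and B₂, so K = B₁Y with B₂B₁Y = 0, and the condition on A₂A₁, B₂B₁
  -- applies to Y.
  · set K := L d.B₂ * L d.B₁₁ with hKd
    have hK1 : R d.B₁ * K = 0 := by rw [hKd, ← Matrix.mul_assoc, ← B₁₁, mul_L_self]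
    have hK2 : d.B₂ * K = 0 := mul_L_self_assoc _ _
    have hK := mul_mpInv_mul_of_R_mul hK1
    set Y := mpInv d.B₁ * K
    have e := mul_mul_eq_zero_of_annihilates c5 (R_mul_self _) (Y := Y)
      (by rw [Matrix.mul_assoc, hK, hK2])
    -- R_{A₁} can be dropped: R_{A₂A₁}A₂ kills the difference, which starts with A₁.
    have f : R (d.A₂ * d.A₁) * (d.A₂ * (R d.A₁ * (d.C₁ * Y)))
        = R (d.A₂ * d.A₁) * (d.A₂ * (d.C₁ * Y)) := by
      have := R_mul_self_assoc (d.A₂ * d.A₁) (mpInv d.A₁ * (d.C₁ * Y))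
      rw [R.eq_1 d.A₁, Matrix.sub_mul, Matrix.one_mul, Matrix.mul_sub, Matrix.mul_sub,
        sub_eq_self, ← this]
      simp only [Matrix.mul_assoc]
    have g : R (d.A₂ * d.A₁) * (d.C₂ * K) = R (d.A₂ * d.A₁) * (d.C₂ * (d.B₁ * Y)) := by rw [hK]
    rw [C₁₁, Matrix.mul_assoc, ← hKd, ← e]
    simp only [Matrix.mul_add, Matrix.add_mul, Matrix.mul_assoc]
    rw [g]
    exact congrArg (· + _) f

theorem RankConditions.second_half (h : d.RankConditions) :
    R d.A₃ * d.C₃ * L d.B₃ = 0 ∧ R d.B₂₂ * d.D₂₂ = 0 ∧ d.D₂₂ * L d.C₂₂ = 0 := by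
  obtain ⟨-, -, c3, c4, -, c6, -⟩ := rankConditions_iff.1 h
  refine ⟨c3, ?_, ?_⟩
  · set J := R d.B₂₂ * R d.A₄ with hJd
    have hJ4 : J * d.A₄ = 0 := by rw [hJd, Matrix.mul_assoc, R_mul_self, Matrix.mul_zero]
    have hJ3 : J * d.A₃ = 0 := by rw [hJd, Matrix.mul_assoc, ← B₂₂, R_mul_self]
    -- A null block column of (B₃, B₄), coming from R_{B₃}B₄L_{A₂₂} = 0.
    have hY : d.B₃ * (-(mpInv d.B₃ * (d.B₄ * L d.A₂₂))) + d.B₄ * L d.A₂₂ = 0 := by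
      have := mul_L_self d.A₂₂
      nth_rewrite 1 [A₂₂] at this
      rw [Matrix.mul_assoc, R, Matrix.sub_mul, Matrix.one_mul] at this
      rw [← this, Matrix.mul_neg, Matrix.mul_assoc]
      abel
    have e := mul_mul_eq_zero_of_annihilates c6 (G := J)
      (Y := fromRows (-(mpInv d.B₃ * (d.B₄ * L d.A₂₂))) (L d.A₂₂))
      (by rw [mul_fromCols, hJ3, hJ4, fromCols_zero]) (by rw [fromCols_mul_fromRows, hY])
    rw [Matrix.mul_assoc, fromCols_mul_fromRows] at e
    rw [D₂₂, ← Matrix.mul_assoc, ← Matrix.mul_assoc, ← hJd, ← neg_eq_zero, ← e]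
    simp only [Matrix.mul_sub, Matrix.sub_mul, Matrix.mul_add, Matrix.mul_assoc, Matrix.mul_neg]
    rw [← Matrix.mul_assoc J (R d.A₃), mul_R_of_mul_eq_zero hJ3]
    abel
  · have hK : d.B₄ * (L d.A₂₂ * L d.C₂₂) = 0 := by rw [← Matrix.mul_assoc, ← C₂₂, mul_L_self]
    have e := mul_mul_eq_zero_of_annihilates c4 (R_mul_self _) hK
    rw [D₂₂, ← neg_eq_zero, ← e]
    simp only [Matrix.mul_sub, Matrix.sub_mul, Matrix.mul_assoc, hK, Matrix.mul_zero, zero_sub,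
      neg_neg]

/-- With all free parameters zero, the mismatch of the two expressions for X₃ is exactly E₁. This
lets E₁ be evaluated through the equations instead of its formula. -/
theorem exists_E₁_eq (h1 : R d.A₁ * d.C₁ * L d.B₁ = 0 ∧ R d.A₁₁ * d.C₁₁ = 0 ∧ d.C₁₁ * L d.B₁₁ = 0)
    (h2 : R d.A₃ * d.C₃ * L d.B₃ = 0 ∧ R d.B₂₂ * d.D₂₂ = 0 ∧ d.D₂₂ * L d.C₂₂ = 0) :
    ∃ (X₁ : Matrix (Fin a₁) (Fin b₁) ℍ[ℝ]) (X₂ : Matrix (Fin a₂) (Fin b₂) ℍ[ℝ])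
      (X₃ X₃' : Matrix (Fin a₃) (Fin b₃) ℍ[ℝ]) (X₄ : Matrix (Fin a₄) (Fin b₄) ℍ[ℝ])
      (X₅ : Matrix (Fin a₅) (Fin b₅) ℍ[ℝ]),
      (d.A₁ * X₁ - X₂ * d.B₁ = d.C₁ ∧ d.A₂ * X₂ - X₃ * d.B₂ = d.C₂) ∧
      (d.A₃ * X₃' - X₄ * d.B₃ = d.C₃ ∧ d.A₄ * X₅ - X₄ * d.B₄ = d.C₄) ∧ d.E₁ = X₃' - X₃ := by
  refine ⟨_, _, _, _, _, _, (d.first_half_iff _ _ _).2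
    ⟨h1, 0, 0, _, 0, 0, 0, _, 0, rfl, rfl, rfl, rfl, rfl⟩, (d.second_half_iff _ _ _).2
    ⟨h2, 0, 0, 0, _, 0, 0, _, 0, rfl, rfl, rfl, rfl, rfl⟩, ?_⟩
  rw [d.third_sub_third h1.2.1 rfl rfl]
  simp

/-- The four conditions come from the four rank conditions containing A₃A₂. On the left, R_A makes J
kill A₂ (otherwise only A₂A₁), and R_M or R_C makes G kill A₄. On the right, L_B puts K in the
column space of B₂B₁ (otherwise of B₂), and L_N or L_D gives B₃K = 0 (otherwise B₃K = B₄Y'). -/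
theorem RankConditions.twoTermConditions (h : d.RankConditions) :
    TwoTermConditions d.A d.B d.C d.D d.E := by
  obtain ⟨X₁, X₂, X₃, X₃', X₄, X₅, ⟨h1, h2⟩, ⟨h3, h4⟩, hE⟩ :=
    exists_E₁_eq h.first_half h.second_half
  obtain ⟨-, -, -, -, -, -, c7, c8, c9, c10⟩ := rankConditions_iff.1 h
  have hA : ∀ {J : Matrix (Fin a₃) (Fin a₃) ℍ[ℝ]}, J * R d.A₃₃ * d.A₃₃ = 0 := by
    intro J
    rw [Matrix.mul_assoc, R_mul_self, Matrix.mul_zero]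
  have hB : ∀ {K : Matrix (Fin b₃) (Fin b₃) ℍ[ℝ]}, d.B₃₃ * (L d.B₃₃ * K) = 0 :=
    mul_L_self_assoc _ _
  refine ⟨?_, ?_, ?_, ?_⟩
  · set J := R (R d.A * d.C) * R d.A * R d.A₃₃ with hJ
    -- The factor 1 only gives K the shape required by `hB`; J gets one in the next case for `hA`.
    set K := L d.B₃₃ * 1 with hK
    have e : R (R d.A * d.C) * R d.A * d.E = J * X₃' * K - J * X₃ * K := by
      rw [← Matrix.sub_mul, ← Matrix.mul_sub, ← hE, E, hJ, hK, Matrix.mul_one]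
      simp only [Matrix.mul_assoc]
    obtain ⟨j1, -⟩ := mul_A₃₃_eq_zero (J := J) hA
    obtain ⟨k1, k2⟩ := B₃₃_mul_eq_zero (K := K) hB
    have j2 := mul_A₂_eq_zero j1 (by
      rw [hJ, Matrix.mul_assoc, ← A, Matrix.mul_assoc, R_mul_self, Matrix.mul_zero])
    obtain ⟨G, hG, hG4⟩ := exists_eq_mul_A₃_of_mul_B₄₄ (J := J) (by
      rw [hJ, Matrix.mul_assoc, ← C, Matrix.mul_assoc, R_mul_self])
    obtain ⟨Y, hY⟩ : ∃ Y : Matrix (Fin b₂) (Fin b₃) ℍ[ℝ], K = d.B₂ * Y :=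
      ⟨_, (mul_mpInv_mul_of_R_mul k1).symm⟩
    obtain ⟨Y', hY'⟩ := exists_B₃_mul_eq_B₄_mul k2
    have f := mul_mul_eq_zero_of_annihilates c7 (G := G) (Y := fromRows Y (-Y'))
      (by rw [mul_fromCols, ← Matrix.mul_assoc, ← hG, j2, hG4, fromCols_zero])
      (by rw [fromCols_mul_fromRows, Matrix.mul_assoc, ← hY, hY', Matrix.mul_neg,
        add_neg_cancel])
    rw [Matrix.mul_assoc, fromCols_mul_fromRows] at f
    rw [e]
    -- Only the K next to X₃ is factored at this point; the K next to X₃' is first handled through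
    -- B₃K.
    nth_rewrite 2 [hY]
    rw [mul_X₃_mul_of_A₂ h2 j2, hG, mul_A₃_mul_X₃_mul_of_A₄ h3 h4 hG4 hY', hY, ← f]
    simp only [Matrix.mul_add, Matrix.add_mul, Matrix.mul_assoc, Matrix.mul_neg]
    abel
  · set J := 1 * R d.A₃₃ with hJ
    set K := L d.B₃₃ * (L d.B * L (d.D * L d.B)) with hK
    have e : d.E * L d.B * L (d.D * L d.B) = J * X₃' * K - J * X₃ * K := by
      rw [← Matrix.sub_mul, ← Matrix.mul_sub, ← hE, E, hJ, hK, Matrix.one_mul]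
      simp only [Matrix.mul_assoc]
    obtain ⟨j1, j3⟩ := mul_A₃₃_eq_zero (J := J) hA
    obtain ⟨k1, -⟩ := B₃₃_mul_eq_zero (K := K) hB
    obtain ⟨G, hG⟩ := exists_eq_mul_A₃ j3
    obtain ⟨Y, hY⟩ := exists_eq_B₂_mul_B₁_mul k1 (by
      rw [hK, ← Matrix.mul_assoc, ← B, mul_L_self_assoc])
    have k3 : d.B₃ * K = 0 := by
      rw [hK, ← Matrix.mul_assoc, ← D, ← Matrix.mul_assoc, mul_L_self]
    have f := mul_mul_eq_zero_of_annihilates c8 (G := G) (Y := Y)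
      (by rw [Matrix.mul_assoc d.A₃, ← Matrix.mul_assoc, ← hG, j1])
      (by rw [Matrix.mul_assoc d.B₃, Matrix.mul_assoc, ← hY, k3])
    rw [e]
    nth_rewrite 2 [hY]
    rw [mul_X₃_mul_of_A₂_mul_A₁ h1 h2 j1, hG, mul_A₃_mul_X₃_mul h3 k3, hY, ← f]
    simp only [Matrix.mul_add, Matrix.add_mul, Matrix.mul_assoc]
    abel
  · set J := R d.A * R d.A₃₃ with hJ
    set K := L d.B₃₃ * L d.D with hK
    have e : R d.A * d.E * L d.D = J * X₃' * K - J * X₃ * K := by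
      rw [← Matrix.sub_mul, ← Matrix.mul_sub, ← hE, E, hJ, hK]
      simp only [Matrix.mul_assoc]
    obtain ⟨j1, j3⟩ := mul_A₃₃_eq_zero (J := J) hA
    obtain ⟨k1, -⟩ := B₃₃_mul_eq_zero (K := K) hB
    have j2 := mul_A₂_eq_zero j1 (by rw [hJ, Matrix.mul_assoc, ← A, R_mul_self])
    obtain ⟨G, hG⟩ := exists_eq_mul_A₃ j3
    obtain ⟨Y, hY⟩ : ∃ Y : Matrix (Fin b₂) (Fin b₃) ℍ[ℝ], K = d.B₂ * Y :=
      ⟨_, (mul_mpInv_mul_of_R_mul k1).symm⟩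
    have k3 : d.B₃ * K = 0 := by rw [hK, ← Matrix.mul_assoc, ← D, mul_L_self]
    have f := mul_mul_eq_zero_of_annihilates c9 (G := G) (Y := Y)
      (by rw [← Matrix.mul_assoc, ← hG, j2]) (by rw [Matrix.mul_assoc, ← hY, k3])
    rw [e]
    nth_rewrite 2 [hY]
    rw [mul_X₃_mul_of_A₂ h2 j2, hG, mul_A₃_mul_X₃_mul h3 k3, hY, ← f]
    simp only [Matrix.mul_add, Matrix.add_mul, Matrix.mul_assoc]
    abel
  · set J := R d.C * R d.A₃₃ with hJ
    set K := L d.B₃₃ * L d.B with hK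
    have e : R d.C * d.E * L d.B = J * X₃' * K - J * X₃ * K := by
      rw [← Matrix.sub_mul, ← Matrix.mul_sub, ← hE, E, hJ, hK]
      simp only [Matrix.mul_assoc]
    obtain ⟨j1, -⟩ := mul_A₃₃_eq_zero (J := J) hA
    obtain ⟨k1, k2⟩ := B₃₃_mul_eq_zero (K := K) hB
    obtain ⟨G, hG, hG4⟩ := exists_eq_mul_A₃_of_mul_B₄₄ (J := J) (by
      rw [hJ, Matrix.mul_assoc, ← C, R_mul_self])
    obtain ⟨Y, hY⟩ := exists_eq_B₂_mul_B₁_mul k1 (by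
      rw [hK, ← Matrix.mul_assoc, ← B, mul_L_self])
    obtain ⟨Y', hY'⟩ := exists_B₃_mul_eq_B₄_mul k2
    have f := mul_mul_eq_zero_of_annihilates c10 (G := G) (Y := fromRows Y (-Y'))
      (by rw [mul_fromCols, Matrix.mul_assoc d.A₃, ← Matrix.mul_assoc G d.A₃, ← hG, j1, hG4,
        fromCols_zero])
      (by rw [fromCols_mul_fromRows, Matrix.mul_assoc d.B₃, Matrix.mul_assoc d.B₃, ← hY, hY',
        Matrix.mul_neg, add_neg_cancel])
    rw [Matrix.mul_assoc, fromCols_mul_fromRows] at f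
    rw [e]
    nth_rewrite 2 [hY]
    rw [mul_X₃_mul_of_A₂_mul_A₁ h1 h2 j1, hG, mul_A₃_mul_X₃_mul_of_A₄ h3 h4 hG4 hY', hY, ← f]
    simp only [Matrix.mul_add, Matrix.add_mul, Matrix.mul_assoc, Matrix.mul_neg]
    abel

theorem consistent_iff_rankConditions : d.Consistent ↔ d.RankConditions :=
  ⟨Consistent.rankConditions, fun h => consistent_iff_projectorConditions.2
    (d.projectorConditions_iff.2 ⟨h.first_half, h.second_half, h.twoTermConditions⟩)⟩

end Data

end QuaternionSylvester

theorem theorem4p1 {a₁ a₂ a₃ a₄ a₅ b₁ b₂ b₃ b₄ b₅ : ℕ}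
    (d : QuaternionSylvester.Data a₁ a₂ a₃ a₄ a₅ b₁ b₂ b₃ b₄ b₅) :
    (d.Consistent ↔ d.RankConditions) ∧
    (d.Consistent ↔ d.ProjectorConditions) ∧
    (d.Consistent →
      (∀ p : QuaternionSylvester.Params a₁ a₂ a₃ a₄ a₅ b₁ b₂ b₃ b₄ b₅, d.X₃ p = d.X₃' p) ∧
      ∀ (X₁ : Matrix (Fin a₁) (Fin b₁) ℍ[ℝ]) (X₂ : Matrix (Fin a₂) (Fin b₂) ℍ[ℝ])
        (X₃ : Matrix (Fin a₃) (Fin b₃) ℍ[ℝ]) (X₄ : Matrix (Fin a₄) (Fin b₄) ℍ[ℝ])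
        (X₅ : Matrix (Fin a₅) (Fin b₅) ℍ[ℝ]),
        d.IsSolution X₁ X₂ X₃ X₄ X₅ ↔
          ∃ p : QuaternionSylvester.Params a₁ a₂ a₃ a₄ a₅ b₁ b₂ b₃ b₄ b₅,
            X₁ = d.X₁ p ∧ X₂ = d.X₂ p ∧ X₃ = d.X₃ p ∧ X₄ = d.X₄ p ∧ X₅ = d.X₅ p) := by
  refine ⟨QuaternionSylvester.Data.consistent_iff_rankConditions,
    QuaternionSylvester.Data.consistent_iff_projectorConditions, fun h => ?_⟩
  have hp := QuaternionSylvester.Data.consistent_iff_projectorConditions.1 h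
  refine ⟨hp.third_eq_third, fun X₁ X₂ X₃ X₄ X₅ => ⟨fun hX => hX.exists_params.2, ?_⟩⟩
  rintro ⟨p, rfl, rfl, rfl, rfl, rfl⟩
  exact hp.isSolution p
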